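/- **Setting.** Let $K\ge 2$, $\sigma>0$, and let $\mu_1,\dots,\mu_K\in\mathbb R$ have a unique maximizer $I^\star=\arg\max_i\mu_i$. At every round $n=1,2,\dots$ an arm $I_n\in\{1,\dots,K\}$ is played and a reward vector $(Y_{n,1},\dots,Y_{n,K})$ is generated with $Y_{n,i}\sim\mathcal N(\mu_i,\sigma^2)$, independently of $I_n$ and of the past $\mathcal F_{n-1}=\sigma(I_1,Y_{1,I_1},\dots,I_{n-1},Y_{n-1,I_{n-1}})$; only $Y_{n,I_n}$ is observed. Put $$T_{n,i}=\sum_{\ell=1}^{n-1}\mathbf 1\{I_\ell=i\},\qquad \mu_{n,i}=\frac1{T_{n,i}}\sum_{\ell=1}^{n-1}\mathbf 1\{I_\ell=i\}\,Y_{\ell,I_\ell}.$$ For the improper (flat) Gaussian prior, the posterior at round $n$, once every arm has been played, is $\Pi_n=\bigotimes_{i=1}^K\mathcal N\!\big(\mu_{n,i},\sigma^2/T_{n,i}\big)$, and $a_{n,i}=\Pi_n\big(\theta_i>\max_{j\ne i}\theta_j\big)$ is the posterior probability that arm $i$ is optimal. **Top-Two Thompson Sampling (TTTS)** with parameter $\beta\in(0,1)$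 plays each arm once in the first $K$ rounds. At each later round $n$, conditionally on $\mathcal F_{n-1}$, it samples $\theta\sim\Pi_n$ and lets $I^{(1)}=\arg\max_i\theta_i$; with probability $\beta$ it plays $I_n=I^{(1)}$; with probability $1-\beta$ it draws independent samples $\theta'\sim\Pi_n$ until $I^{(2)}=\arg\max_i\theta'_i$ differs from $I^{(1)}$, and plays $I_n=I^{(2)}$. **Optimal rate.** With $d(x;y)=(x-y)^2/(2\sigma^2)$, let for $i\neq I^\star$ $$C_i(\omega,\omega')=\min_{x\in\mathbb R}\ \omega\, d(\mu_{I^\star};x)+\omega'\, d(\mu_i;x),\qquad \Gamma^\star_\beta=\max_{\omega}\ \min_{i\neq I^\star}C_i(\omega_{I^\star},\omega_i),$$ the maximum being over the vectors $\omega\in[0,1]^K$ with $\sum_k\omega_k=1$ and $\omega_{I^\star}=\beta$. **Theorem.** Under TTTS with parameter $\beta\in(0,1)$, almost surely $$\lim_{n\to\infty}-\frac1n\log\big(1-a_{n,I^\star}\big)=\Gamma^\star_\beta .$$ Moreover the maximization problem defining $\Gamma^\star_\beta$ has a unique solution $\omega^\beta$, and almost surely $T_{n,i}/n\to\omega_i^\beta$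 for every arm $i$. -/

import Mathlib

open MeasureTheory ProbabilityTheory Filter Topology

namespace GaussianTopTwo

noncomputable section

/-! ## The optimal rate and the optimal allocation -/

/-- Kullback-Leibler divergence between Gaussian distributions with means `x`, `y` and common
standard deviation `σ`. -/
def kl (σ x y : ℝ) : ℝ := (x - y) ^ 2 / (2 * σ ^ 2)

/-- The transportation cost `C_i(w, w') = min_x (w d(μ_{I*}; x) + w' d(μ_i; x))`, where `istar` is
the best arm. -/
def cost {K : ℕ} (σ : ℝ) (μ : Fin K → ℝ) (istar i : Fin K) (w w' : ℝ) : ℝ :=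
  ⨅ x : ℝ, w * kl σ (μ istar) x + w' * kl σ (μ i) x

/-- `min_{i ≠ I*} C_i(w_{I*}, w_i)`. -/
def minCost {K : ℕ} (σ : ℝ) (μ : Fin K → ℝ) (istar : Fin K) (w : Fin K → ℝ) : ℝ :=
  ⨅ i : {i : Fin K // i ≠ istar}, cost σ μ istar i (w istar) (w i)

/-- Probability vectors over the arms that give mass `β` to the best arm. -/
def allocations {K : ℕ} (istar : Fin K) (β : ℝ) : Set (Fin K → ℝ) :=
  {w | w ∈ stdSimplex ℝ (Fin K) ∧ w istar = β}

/-- `Γ*_β`, the maximum of `minCost` over `allocations`. -/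
def optimalRate {K : ℕ} (σ : ℝ) (μ : Fin K → ℝ) (istar : Fin K) (β : ℝ) : ℝ :=
  sSup (minCost σ μ istar '' allocations istar β)

/-- `w` solves the optimization problem that defines `Γ*_β`. -/
def IsOptimalAllocation {K : ℕ} (σ : ℝ) (μ : Fin K → ℝ) (istar : Fin K) (β : ℝ)
    (w : Fin K → ℝ) : Prop :=
  w ∈ allocations istar β ∧ IsMaxOn (minCost σ μ istar) (allocations istar β) w

/-! ## The posterior -/

/-- The posterior on the vector of means, for the improper (flat) Gaussian prior, when arm `i` has
been observed `T i ≥ 1` times with empirical mean `m i`: the product of the distributions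
`N(m i, σ² / T i)`. -/
def posterior {K : ℕ} (σ : ℝ) (m : Fin K → ℝ) (T : Fin K → ℕ) : Measure (Fin K → ℝ) :=
  Measure.pi fun i => gaussianReal (m i) (σ ^ 2 / (T i : ℝ)).toNNReal

instance {K : ℕ} (σ : ℝ) (m : Fin K → ℝ) (T : Fin K → ℕ) :
    IsProbabilityMeasure (posterior σ m T) := by
  unfold posterior; infer_instance

/-- Probability under `Q` that arm `i` is the (strictly) best arm. -/
def optimalProb {K : ℕ} (Q : Measure (Fin K → ℝ)) (i : Fin K) : ℝ :=
  Q.real {θ | ∀ j, j ≠ i → θ j < θ i}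

/-! ## The top-two Thompson sampling step -/

/-- An arm with maximal coordinate in `θ` (the one of least index, in case of ties). -/
def argmaxArm {K : ℕ} [NeZero K] (θ : Fin K → ℝ) : Fin K := by
  classical
  exact (Finset.univ.filter fun i => ∀ j, θ j ≤ θ i).min' (by
    obtain ⟨i, hi⟩ := Finite.exists_max θ
    exact ⟨i, by simpa using hi⟩)

/-- The challenger that is obtained from the first sample `θ` and the successive further samples
`θ' 0, θ' 1, …`: resampling stops as soon as the best arm of the new sample differs from the best
arm of `θ`. -/
def challenger {K : ℕ} [NeZero K] (θ : Fin K → ℝ) (θ' : ℕ → Fin K → ℝ) : Fin K :=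
  argmaxArm (θ' (sInf {m : ℕ | argmaxArm (θ' m) ≠ argmaxArm θ}))

/-- Probability that one step of top-two Thompson sampling with posterior `Q` plays arm `i`: with
probability `β` it plays the best arm of a sample `θ ∼ Q`, and with probability `1 - β` it plays
the challenger, where the further samples are i.i.d. from `Q` and independent of `θ`. -/
def stepProb {K : ℕ} [NeZero K] (β : ℝ) (Q : Measure (Fin K → ℝ)) [IsProbabilityMeasure Q]
    (i : Fin K) : ℝ :=
  β * Q.real {θ | argmaxArm θ = i} +
    (1 - β) * (Q.prod (Measure.infinitePi fun _ : ℕ => Q)).real {p | challenger p.1 p.2 = i}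

/-! ## The bandit process

Rounds are numbered `1, 2, …`. In round `n`, `I n` is the arm that is played and `Y n` is the
vector of the rewards of all arms, of which only `Y n (I n)` is observed. -/

section Rounds

variable {K : ℕ} {Ω : Type*}

/-- `T_{n,i}`, the number of rounds before round `n` in which arm `i` is played. -/
def pulls (I : ℕ → Ω → Fin K) (n : ℕ) (ω : Ω) (i : Fin K) : ℕ :=
  ((Finset.Ico 1 n).filter fun l => I l ω = i).card

/-- `μ_{n,i}`, the mean of the rewards observed from arm `i` before round `n`. -/
def empMean (I : ℕ → Ω → Fin K) (Y : ℕ → Ω → Fin K → ℝ) (n : ℕ) (ω : Ω) (i : Fin K) : ℝ :=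
  (∑ l ∈ Finset.Ico 1 n, if I l ω = i then Y l ω (I l ω) else 0) / (pulls I n ω i : ℝ)

/-- `Π_n`, the posterior at the beginning of round `n`. -/
def posteriorAt (σ : ℝ) (I : ℕ → Ω → Fin K) (Y : ℕ → Ω → Fin K → ℝ) (n : ℕ) (ω : Ω) :
    Measure (Fin K → ℝ) :=
  posterior σ (empMean I Y n ω) (pulls I n ω)

instance (σ : ℝ) (I : ℕ → Ω → Fin K) (Y : ℕ → Ω → Fin K → ℝ) (n : ℕ) (ω : Ω) :
    IsProbabilityMeasure (posteriorAt σ I Y n ω) := by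
  unfold posteriorAt; infer_instance

/-- The σ-algebra of the arms played and the rewards observed before round `n`. -/
@[reducible] def history (I : ℕ → Ω → Fin K) (Y : ℕ → Ω → Fin K → ℝ) (n : ℕ) : MeasurableSpace Ω :=
  ⨆ l ∈ Finset.Ico 1 n,
    MeasurableSpace.comap (fun ω => (I l ω, Y l ω (I l ω))) inferInstance

/-- The arms `I` and the rewards `Y` are those of top-two Thompson sampling with parameter `β` and
flat priors, on the Gaussian bandit with means `μ` and standard deviation `σ`. -/
structure IsTTTS [NeZero K] [MeasurableSpace Ω] (P : Measure Ω) (σ : ℝ) (μ : Fin K → ℝ) (β : ℝ)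
    (I : ℕ → Ω → Fin K) (Y : ℕ → Ω → Fin K → ℝ) : Prop where
  measurable_arm : ∀ n, 1 ≤ n → Measurable (I n)
  measurable_reward : ∀ n, 1 ≤ n → Measurable (Y n)
  /-- The reward of arm `i` has distribution `N(μ i, σ²)`. -/
  law_reward : ∀ n, 1 ≤ n → ∀ i,
    P.map (fun ω => Y n ω i) = gaussianReal (μ i) (σ ^ 2).toNNReal
  /-- The rewards of round `n` are independent of the past and of the choice of the arm. -/
  indep_reward : ∀ n, 1 ≤ n →
    Indep (MeasurableSpace.comap (Y n) inferInstance)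
      (history I Y n ⊔ MeasurableSpace.comap (I n) inferInstance) P
  /-- In the first `K` rounds each arm is played once. -/
  init : ∀ᵐ ω ∂P, ∀ i, pulls I (K + 1) ω i = 1
  /-- Afterwards, given the past, the arm is chosen by a step of top-two Thompson sampling. -/
  step : ∀ n, K < n → ∀ i,
    P[(I n ⁻¹' {i}).indicator (fun _ => (1 : ℝ)) | history I Y n]
      =ᵐ[P] fun ω => stepProb β (posteriorAt σ I Y n ω) i

end Rounds

end

end GaussianTopTwo

/-! Optimization. Completing the square (`cost_eq`) turns the transportation cost into `kl` times
`halfHarm w w'`, which is strictly increasing in the weight of the suboptimal arm. An allocation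
that equalises the costs is therefore the unique maximizer: any other one gives less to some
suboptimal arm, whose cost then drops below the common value `r`, so `r` is the optimal rate.

Probability. Randomness enters only through two martingale laws of large numbers, both obtained from
L² martingale convergence and Kronecker's lemma: empirical means of infinitely played arms are
consistent, and the number of plays of an arm differs by o(n) from the sum of its conditional play
probabilities. `RegularPath` collects these facts, and everything afterwards is deterministic.

Dynamics. An arm played finitely often would keep a posterior probability of optimality bounded
below, hence would be played linearly often, a contradiction. So the posterior concentrates on
`istar`, which is then played with probability tending to β. Write α for `armProb`. Another arm i is
played with probability at most α_i + (1 - α_istar) + α_i / (1 - α_istar), the last term being the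
geometric series of the resampling. Gaussian tails make α_i at most exp(-n · cost of i), and 1 -
α_istar at least exp(-n · cost of j) up to subexponential factors, for every j ≠ istar. If i exceeds
its optimal proportion by δ, some other j falls below its own and has a strictly smaller cost, so
the ratio vanishes (`eventually_stepProb_le`). Thus i is almost never played while oversampled, its
proportion has limsup at most w i (`eventually_le_of_small_above`), and since proportions sum to one
in the limit, they converge. All costs then tend to `r`, and the same tail bounds give the rate. -/

namespace GaussianTopTwo

/-! ### Kronecker's lemma and L² martingale convergence -/

/-- Summation by parts. -/
lemma sum_mul_sub_eq (b R : ℕ → ℝ) (n : ℕ) :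
    ∑ l ∈ Finset.range n, b (l + 1) * (R (l + 1) - R l) =
      b n * R n - b 0 * R 0 - ∑ l ∈ Finset.range n, (b (l + 1) - b l) * R l := by
  induction n with
  | zero => simp
  | succ n ih => rw [Finset.sum_range_succ, ih, Finset.sum_range_succ]; ring

/-- Kronecker's lemma. -/
lemma tendsto_sum_mul_sub_div {b S : ℕ → ℝ} {s : ℝ} (hmono : Monotone b)
    (hb : Tendsto b atTop atTop) (hS : Tendsto S atTop (𝓝 s)) :
    Tendsto (fun n => (∑ l ∈ Finset.range n, b (l + 1) * (S (l + 1) - S l)) / b n)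
      atTop (𝓝 0) := by
  set R : ℕ → ℝ := fun n => S n - s with hR
  have hR0 : Tendsto R atTop (𝓝 0) := by
    simpa [hR] using hS.sub_const s
  have hsum : ∀ n, ∑ l ∈ Finset.range n, (b (l + 1) - b l) = b n - b 0 := fun n =>
    Finset.sum_range_sub b n
  -- After summation by parts, what remains is an average of `R` weighted by the increments of `b`,
  -- and `R` tends to 0.
  have h1 : (fun l => (b (l + 1) - b l) * R l) =o[atTop] fun l => b (l + 1) - b l := by
    have := (Asymptotics.isBigO_refl (fun l => b (l + 1) - b l) atTop).mul_isLittleO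
      ((Asymptotics.isLittleO_one_iff ℝ).2 hR0)
    simpa using this
  have h2 := h1.sum_range (fun l => sub_nonneg.2 (hmono (Nat.le_succ l)))
    (by simp only [hsum]; exact tendsto_atTop_add_const_right _ (-b 0) hb)
  simp only [hsum] at h2
  have h3 : (fun n => b n - b 0) =O[atTop] b := by
    refine (Asymptotics.isBigO_refl _ _).sub ?_
    exact ((Asymptotics.isLittleO_const_left (c := b 0)).2
      (Or.inr (tendsto_norm_atTop_atTop.comp hb))).isBigO
  have h4 := (h2.trans_isBigO h3).tendsto_div_nhds_zero
  have h5 : Tendsto (fun n => b 0 * R 0 / b n) atTop (𝓝 0) := hb.const_div_atTop _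
  have h6 := (hR0.sub h5).sub h4
  simp only [sub_zero] at h6
  refine h6.congr' ?_
  filter_upwards [hb.eventually_gt_atTop 0] with n hn
  have : ∀ l, S (l + 1) - S l = R (l + 1) - R l := fun l => by simp [hR]
  simp only [this]
  rw [sum_mul_sub_eq]
  field_simp

/-- A sum of square-integrable martingale differences converges almost surely when its second
moments are bounded. -/
lemma ae_exists_tendsto_sum_of_sq_bdd {Ω : Type*} {m0 : MeasurableSpace Ω} {P : Measure Ω}
    [IsProbabilityMeasure P] (ℱ : Filtration ℕ m0) (D : ℕ → Ω → ℝ)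
    (hmeas : ∀ n, StronglyMeasurable[ℱ (n + 1)] (D n)) (hL2 : ∀ n, MemLp (D n) 2 P)
    (hce : ∀ n, P[D n | ℱ n] =ᵐ[P] 0) (C : ℝ)
    (hC : ∀ n, ∑ l ∈ Finset.range n, ∫ ω, D l ω ^ 2 ∂P ≤ C) :
    ∀ᵐ ω ∂P, ∃ s, Tendsto (fun n => ∑ l ∈ Finset.range n, D l ω) atTop (𝓝 s) := by
  set S : ℕ → Ω → ℝ := fun n ω => ∑ l ∈ Finset.range n, D l ω with hS
  have hSsucc : ∀ n, S (n + 1) = S n + D n := fun n => by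
    ext ω; simp [hS, Finset.sum_range_succ]
  have hSm : ∀ n, StronglyMeasurable[ℱ n] (S n) := by
    intro n
    refine Finset.stronglyMeasurable_fun_sum _ fun l hl => (hmeas l).mono (ℱ.mono ?_)
    exact Finset.mem_range.1 hl
  have hS2 : ∀ n, MemLp (S n) 2 P := fun n => memLp_finsetSum _ fun l _ => hL2 l
  have hmart : Martingale S ℱ P := by
    refine martingale_of_condExp_sub_eq_zero_nat (fun n => hSm n)
      (fun n => (hS2 n).integrable (by norm_num)) fun n => ?_
    rw [hSsucc, add_sub_cancel_left]
    exact hce n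
  have horth : ∀ n, ∫ ω, S n ω * D n ω ∂P = 0 := by
    intro n
    have hint : Integrable (S n * D n) P := (hS2 n).integrable_mul (hL2 n)
    have h := condExp_mul_of_stronglyMeasurable_left (hSm n) hint
      ((hL2 n).integrable (by norm_num))
    have : ∫ ω, (S n * D n) ω ∂P = 0 := by
      rw [← integral_condExp (ℱ.le n), integral_congr_ae h]
      have : (S n * P[D n | ℱ n]) =ᵐ[P] 0 := by
        filter_upwards [hce n] with ω hω
        simp [hω]
      rw [integral_congr_ae this]; simp
    simpa using this
  have hsq : ∀ n, ∫ ω, S n ω ^ 2 ∂P = ∑ l ∈ Finset.range n, ∫ ω, D l ω ^ 2 ∂P := by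
    intro n
    induction n with
    | zero => simp [hS]
    | succ n ih =>
      rw [Finset.sum_range_succ, ← ih, hSsucc]
      have e : ∀ ω, (S n + D n) ω ^ 2 = S n ω ^ 2 + 2 * (S n ω * D n ω) + D n ω ^ 2 := by
        intro ω; simp only [Pi.add_apply]; ring
      simp only [e]
      have i1 := (hS2 n).integrable_sq
      have i2 : Integrable (fun ω => 2 * (S n ω * D n ω)) P :=
        ((hS2 n).integrable_mul (hL2 n)).const_mul 2
      have i3 := (hL2 n).integrable_sq
      have i12 : Integrable (fun ω => S n ω ^ 2 + 2 * (S n ω * D n ω)) P := i1.add i2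
      rw [integral_add i12 i3, integral_add i1 i2, integral_const_mul, horth]
      ring
  -- Orthogonality of the increments bounds the second moments; |x| ≤ 1 + x² converts this into the
  -- L¹ bound that martingale convergence requires.
  have hbdd : ∀ n, eLpNorm (S n) 1 P ≤ ((1 + C).toNNReal : ENNReal) := by
    intro n
    rw [eLpNorm_one_eq_lintegral_enorm]
    have hi : Integrable (S n) P := (hS2 n).integrable (by norm_num)
    rw [← ofReal_integral_norm_eq_lintegral_enorm hi]
    refine ENNReal.ofReal_le_ofReal ?_
    calc ∫ ω, ‖S n ω‖ ∂P ≤ ∫ ω, (1 + S n ω ^ 2) ∂P := by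
          refine integral_mono hi.norm ((integrable_const _).add (hS2 n).integrable_sq) fun ω => ?_
          simp only [Real.norm_eq_abs]
          nlinarith [sq_abs (S n ω), sq_nonneg (|S n ω| - 1), abs_nonneg (S n ω)]
      _ = 1 + ∑ l ∈ Finset.range n, ∫ ω, D l ω ^ 2 ∂P := by
          rw [integral_add (integrable_const _) (hS2 n).integrable_sq, hsq]; simp
      _ ≤ 1 + C := by linarith [hC n]
  exact hmart.submartingale.exists_ae_tendsto_of_bdd hbdd

/-! ### The optimal allocation -/

/-- Half of the harmonic mean of `a` and `b`. -/
noncomputable def halfHarm (a b : ℝ) : ℝ := a * b / (a + b)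

lemma halfHarm_le_right {a b b' : ℝ} (ha : 0 < a) (hb : 0 ≤ b) (h : b ≤ b') :
    halfHarm a b ≤ halfHarm a b' := by
  unfold halfHarm
  rw [div_le_div_iff₀ (by linarith) (by linarith)]
  nlinarith [mul_nonneg (mul_nonneg ha.le ha.le) (sub_nonneg.2 h)]

lemma halfHarm_lt_right {a b b' : ℝ} (ha : 0 < a) (hb : 0 ≤ b) (h : b < b') :
    halfHarm a b < halfHarm a b' := by
  unfold halfHarm
  rw [div_lt_div_iff₀ (by linarith) (by linarith)]
  nlinarith [mul_pos (mul_pos ha ha) (sub_pos.2 h)]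

lemma halfHarm_nonneg {a b : ℝ} (ha : 0 ≤ a) (hb : 0 ≤ b) : 0 ≤ halfHarm a b := by
  unfold halfHarm; positivity

lemma tendsto_halfHarm {ι : Type*} {l : Filter ι} {f g : ι → ℝ} {a b : ℝ} (ha : 0 < a)
    (hb : 0 ≤ b) (hf : Tendsto f l (𝓝 a)) (hg : Tendsto g l (𝓝 b)) :
    Tendsto (fun n => halfHarm (f n) (g n)) l (𝓝 (halfHarm a b)) :=
  (hf.mul hg).div (hf.add hg) (by positivity)

/-- Completing the square in `x`: the minimum is attained at the weighted mean of the two arm means.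
-/
lemma cost_eq {K : ℕ} {σ : ℝ} (hσ : 0 < σ) (μ : Fin K → ℝ) (istar i : Fin K) {w w' : ℝ}
    (hw : 0 < w) (hw' : 0 ≤ w') :
    cost σ μ istar i w w' = kl σ (μ istar) (μ i) * halfHarm w w' := by
  have key : ∀ x, w * kl σ (μ istar) x + w' * kl σ (μ i) x =
      kl σ (μ istar) (μ i) * halfHarm w w' +
        (w + w') * (x - (w * μ istar + w' * μ i) / (w + w')) ^ 2 / (2 * σ ^ 2) := by
    intro x
    have : w + w' ≠ 0 := by positivity
    unfold kl halfHarm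
    field_simp
    ring
  have lb : ∀ x, kl σ (μ istar) (μ i) * halfHarm w w' ≤
      w * kl σ (μ istar) x + w' * kl σ (μ i) x := by
    intro x
    rw [key]
    have : 0 ≤ (w + w') * (x - (w * μ istar + w' * μ i) / (w + w')) ^ 2 / (2 * σ ^ 2) := by
      positivity
    linarith
  unfold cost
  refine le_antisymm ?_ (le_ciInf lb)
  refine (ciInf_le ⟨_, Set.forall_mem_range.2 lb⟩ ((w * μ istar + w' * μ i) / (w + w'))).trans
    (le_of_eq ?_)
  rw [key]; simp

/-- There is an allocation that equalises the transportation costs. -/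
lemma exists_equalizing_allocation {ι : Type*} [DecidableEq ι] (s : Finset ι) (hs : s.Nonempty)
    {β : ℝ} (hβ₀ : 0 < β) (hβ₁ : β < 1) (c : ι → ℝ) (hc : ∀ i ∈ s, 0 < c i) :
    ∃ (w : ι → ℝ) (r : ℝ), (∀ i ∈ s, 0 < w i ∧ c i * halfHarm β (w i) = r) ∧
      ∑ i ∈ s, w i = 1 - β := by
  obtain ⟨i₀, hi₀, hmin⟩ := Finset.exists_min_image s c hs
  have hc₀ := hc i₀ hi₀
  have h1β : 0 < 1 - β := by linarith
  -- Solving `c i * halfHarm β (w i) = 1 / t` gives `w i = 1 / (c i * t - 1 / β)`, which is positive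
  -- when t > 1 / (c i * β). The smallest `c` gives the largest such threshold `t₀`; below, t = t₀ +
  -- u.
  set t₀ : ℝ := 1 / (c i₀ * β) with ht₀
  have ht₀pos : 0 < t₀ := by positivity
  have hden : ∀ i ∈ s, ∀ u, 0 < u → c i₀ * u ≤ c i * (t₀ + u) - 1 / β := by
    intro i hi u hu
    have h1 : c i₀ * t₀ = 1 / β := by rw [ht₀]; field_simp
    have := mul_le_mul_of_nonneg_right (hmin i hi) (add_pos ht₀pos hu).le
    nlinarith
  have hdpos : ∀ i ∈ s, ∀ u, 0 < u → 0 < c i * (t₀ + u) - 1 / β := fun i hi u hu =>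
    lt_of_lt_of_le (mul_pos hc₀ hu) (hden i hi u hu)
  set f : ℝ → ℝ := fun u => ∑ i ∈ s, 1 / (c i * (t₀ + u) - 1 / β) with hf
  -- At `u = a` the term of `i₀` alone equals 1 - β; at `u = b` each term is at most (1 - β) / card
  -- s. The intermediate value theorem applies between them.
  set a : ℝ := 1 / (c i₀ * (1 - β)) with ha
  set b : ℝ := s.card / (c i₀ * (1 - β)) with hb
  have hcard : (1 : ℝ) ≤ s.card := by exact_mod_cast hs.card_pos
  have hapos : 0 < a := by positivity
  have hab : a ≤ b := by rw [ha, hb]; gcongr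
  have hbpos : 0 < b := hapos.trans_le hab
  have hfa : 1 - β ≤ f a := by
    have h1 : 1 / (c i₀ * (t₀ + a) - 1 / β) = 1 - β := by
      have : c i₀ * (t₀ + a) - 1 / β = 1 / (1 - β) := by
        rw [ht₀, ha]; field_simp; ring
      rw [this]; simp
    rw [← h1, hf]
    exact Finset.single_le_sum (f := fun i => 1 / (c i * (t₀ + a) - 1 / β))
      (fun i hi => (one_div_pos.2 (hdpos i hi a hapos)).le) hi₀
  have hfb : f b ≤ 1 - β := by
    calc f b ≤ ∑ i ∈ s, 1 / (c i₀ * b) := by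
          refine Finset.sum_le_sum fun i hi => ?_
          exact one_div_le_one_div_of_le (by positivity) (hden i hi b hbpos)
      _ = 1 - β := by
          rw [Finset.sum_const, nsmul_eq_mul, hb]; field_simp
  have hcont : ContinuousOn f (Set.Icc a b) := by
    refine continuousOn_finsetSum _ fun i hi => ?_
    refine ContinuousOn.div continuousOn_const (by fun_prop) fun u hu => ?_
    exact (hdpos i hi u (hapos.trans_le hu.1)).ne'
  obtain ⟨u, hu, hfu⟩ := intermediate_value_Icc' hab hcont ⟨hfb, hfa⟩
  have hupos : 0 < u := hapos.trans_le hu.1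
  refine ⟨fun i => 1 / (c i * (t₀ + u) - 1 / β), 1 / (t₀ + u), fun i hi => ?_, hfu⟩
  have hd := hdpos i hi u hupos
  refine ⟨one_div_pos.2 hd, ?_⟩
  have hci := hc i hi
  unfold halfHarm
  set d := c i * (t₀ + u) - 1 / β with hdd
  have h2 : c i * (t₀ + u) * β = d * β + 1 := by rw [hdd]; field_simp; ring
  have h3 : 0 < t₀ + u := by positivity
  change c i * (β * (1 / d) / (β + 1 / d)) = 1 / (t₀ + u)
  clear_value d
  field_simp
  linarith

lemma kl_pos {σ x y : ℝ} (hσ : 0 < σ) (h : y < x) : 0 < kl σ x y := by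
  unfold kl
  have : 0 < x - y := by linarith
  positivity

lemma exists_optimalAllocation {K : ℕ} (hK : 2 ≤ K) {σ : ℝ} (hσ : 0 < σ) (μ : Fin K → ℝ)
    (istar : Fin K) (histar : ∀ i, i ≠ istar → μ i < μ istar)
    {β : ℝ} (hβ₀ : 0 < β) (hβ₁ : β < 1) :
    ∃ w : Fin K → ℝ, w istar = β ∧ ∑ i, w i = 1 ∧
      (∀ i, i ≠ istar → 0 < w i ∧
        kl σ (μ istar) (μ i) * halfHarm β (w i) = optimalRate σ μ istar β) ∧
      ∀ w', IsOptimalAllocation σ μ istar β w' ↔ w' = w := by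
  have : Nontrivial (Fin K) := Fin.nontrivial_iff_two_le.2 hK
  obtain ⟨j₀, hj₀⟩ := exists_ne istar
  have : Nonempty {i : Fin K // i ≠ istar} := ⟨⟨j₀, hj₀⟩⟩
  obtain ⟨v, r, hv, hvsum⟩ := exists_equalizing_allocation (Finset.univ.erase istar)
    ⟨j₀, by simp [hj₀]⟩ hβ₀ hβ₁ (fun i => kl σ (μ istar) (μ i))
    (fun i hi => kl_pos hσ (histar i (Finset.ne_of_mem_erase hi)))
  set w : Fin K → ℝ := Function.update v istar β with hw
  have hwstar : w istar = β := by simp [hw]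
  have hwne : ∀ i, i ≠ istar → w i = v i := fun i hi => by simp [hw, hi]
  have hwpos : ∀ i, i ≠ istar → 0 < w i ∧ kl σ (μ istar) (μ i) * halfHarm β (w i) = r := by
    intro i hi
    rw [hwne i hi]
    exact hv i (by simp [hi])
  have hwsum : ∑ i, w i = 1 := by
    rw [← Finset.add_sum_erase _ _ (Finset.mem_univ istar), hwstar,
      Finset.sum_congr rfl fun i hi => hwne i (Finset.ne_of_mem_erase hi), hvsum]
    ring
  have hwmem : w ∈ allocations istar β := by
    refine ⟨⟨fun i => ?_, hwsum⟩, hwstar⟩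
    by_cases hi : i = istar
    · rw [hi, hwstar]; exact hβ₀.le
    · exact (hwpos i hi).1.le
  have hval : minCost σ μ istar w = r := by
    unfold minCost
    have : ∀ i : {i : Fin K // i ≠ istar}, cost σ μ istar i (w istar) (w i) = r := fun i => by
      rw [hwstar, cost_eq hσ μ istar i hβ₀ (hwpos i i.2).1.le]
      exact (hwpos i i.2).2
    simp [this]
  -- Both vectors sum to 1, so `w'` is strictly below `w` at some arm, which is not `istar` because
  -- both have the value β there.
  have hlt : ∀ w' ∈ allocations istar β, w' ≠ w → minCost σ μ istar w' < r := by
    intro w' hw' hne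
    obtain ⟨i, hi⟩ : ∃ i, w' i < w i := by
      by_contra! hcon
      refine hne (funext fun i => ?_)
      have := (Finset.sum_eq_sum_iff_of_le (s := Finset.univ) (f := w) (g := w')
        (fun i _ => hcon i)).1 (by rw [hwsum, hw'.1.2])
      exact (this i (Finset.mem_univ i)).symm
    have hii : i ≠ istar := by
      rintro rfl
      rw [hwstar, hw'.2] at hi
      exact lt_irrefl _ hi
    calc minCost σ μ istar w' ≤ cost σ μ istar i (w' istar) (w' i) :=
          ciInf_le (Set.finite_range _).bddBelow (⟨i, hii⟩ : {i : Fin K // i ≠ istar})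
      _ = kl σ (μ istar) (μ i) * halfHarm β (w' i) := by
          rw [hw'.2, cost_eq hσ μ istar i hβ₀ (hw'.1.1 i)]
      _ < kl σ (μ istar) (μ i) * halfHarm β (w i) :=
          mul_lt_mul_of_pos_left (halfHarm_lt_right hβ₀ (hw'.1.1 i) hi)
            (kl_pos hσ (histar i hii))
      _ = r := (hwpos i hii).2
  have hle : ∀ w' ∈ allocations istar β, minCost σ μ istar w' ≤ r := fun w' hw' => by
    by_cases h : w' = w
    · rw [h, hval]
    · exact (hlt w' hw' h).le
  have hopt : optimalRate σ μ istar β = r := by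
    refine IsGreatest.csSup_eq ⟨⟨w, hwmem, hval⟩, ?_⟩
    rintro _ ⟨w', hw', rfl⟩
    exact hle w' hw'
  refine ⟨w, hwstar, hwsum, hopt ▸ hwpos, fun w' => ⟨fun h => ?_, ?_⟩⟩
  · by_contra hne
    have := h.2 hwmem
    simp only [Set.mem_ofPred_eq, hval] at this
    exact absurd this (not_le.2 (hlt w' h.1 hne))
  · rintro rfl
    refine ⟨hwmem, fun w' hw' => ?_⟩
    simp only [Set.mem_ofPred_eq, hval]
    exact hle w' hw'

/-! ### Gaussian tails -/

/-- Chernoff's bound at the optimal parameter (x - m) / v. -/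
lemma gaussianReal_real_Ici_le (m : ℝ) {v : NNReal} (hv : v ≠ 0) {x : ℝ} (hx : m ≤ x) :
    (gaussianReal m v).real (Set.Ici x) ≤ Real.exp (-((x - m) ^ 2 / (2 * v))) := by
  have hv' : (0 : ℝ) < v := NNReal.coe_pos.2 (pos_iff_ne_zero.2 hv)
  have h := measure_ge_le_exp_mul_mgf (μ := gaussianReal m v) (X := id) (t := (x - m) / v) x
    (div_nonneg (by linarith) hv'.le) (integrable_exp_mul_gaussianReal _)
  rw [mgf_id_gaussianReal] at h
  simp only [← Real.exp_add] at h
  refine h.trans (le_of_eq ?_)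
  congr 1
  field_simp
  ring

/-- Only the interval (x, x + √v] is kept, with the density bounded by its value at the right end.
The length √v cancels the normalisation of the density, so the prefactor does not depend on the
variance. -/
lemma le_gaussianReal_real_Ioi (m : ℝ) {v : NNReal} (hv : v ≠ 0) {x : ℝ} (hx : m ≤ x) :
    (√(2 * Real.pi))⁻¹ * Real.exp (-((x - m) / √v + 1) ^ 2 / 2) ≤
      (gaussianReal m v).real (Set.Ioi x) := by
  have hv' : (0 : ℝ) < v := NNReal.coe_pos.2 (pos_iff_ne_zero.2 hv)
  have hs : 0 < √(v : ℝ) := Real.sqrt_pos.2 hv'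
  have hsq : √(v : ℝ) ^ 2 = v := Real.sq_sqrt hv'.le
  have h1 : (gaussianReal m v).real (Set.Ioc x (x + √v)) =
      ∫ y in Set.Ioc x (x + √v), gaussianPDFReal m v y := by
    rw [Measure.real, gaussianReal_apply_eq_integral m hv, ENNReal.toReal_ofReal]
    exact integral_nonneg fun y => gaussianPDFReal_nonneg m v y
  have h2 : gaussianPDFReal m v (x + √v) * volume.real (Set.Ioc x (x + √v)) ≤
      ∫ y in Set.Ioc x (x + √v), gaussianPDFReal m v y := by
    refine setIntegral_ge_of_const_le_real measurableSet_Ioc (by simp) (fun y hy => ?_)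
      (integrable_gaussianPDFReal m v).integrableOn
    unfold gaussianPDFReal
    refine mul_le_mul_of_nonneg_left (Real.exp_le_exp.2 ?_) (by positivity)
    gcongr
    · linarith [hy.1]
    · exact hy.2
  refine le_trans (le_of_eq ?_) (h2.trans (h1.symm.le.trans
    (measureReal_mono (fun y hy => hy.1))))
  have h3 : volume.real (Set.Ioc x (x + √v)) = √v := by
    simp [Measure.real, Real.volume_Ioc, Real.sqrt_nonneg]
  rw [h3]
  unfold gaussianPDFReal
  have h4 : -(x + √(v : ℝ) - m) ^ 2 / (2 * v) = -((x - m) / √v + 1) ^ 2 / 2 := by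
    nth_rewrite 2 [← hsq]
    field_simp
    ring
  rw [Real.sqrt_mul (by positivity : 0 ≤ 2 * Real.pi), mul_inv, h4]
  field_simp

/-! ### Posterior probabilities of comparisons between arms -/

section Posterior

variable {K : ℕ} {σ : ℝ} (m : Fin K → ℝ) (T : Fin K → ℕ)

/-- The variance of `θ j - θ k` under the posterior. -/
noncomputable def diffVar {K : ℕ} (σ : ℝ) (T : Fin K → ℕ) (j k : Fin K) : NNReal :=
  (σ ^ 2 / (T j : ℝ)).toNNReal + (σ ^ 2 / (T k : ℝ)).toNNReal

lemma var_ne_zero (hσ : 0 < σ) {t : ℕ} (ht : 1 ≤ t) : (σ ^ 2 / (t : ℝ)).toNNReal ≠ 0 := by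
  have : (0 : ℝ) < t := by exact_mod_cast ht
  have : 0 < σ ^ 2 / (t : ℝ) := by positivity
  exact (Real.toNNReal_pos.2 this).ne'

lemma diffVar_ne_zero (hσ : 0 < σ) {j k : Fin K} (hj : 1 ≤ T j) : diffVar σ T j k ≠ 0 := by
  unfold diffVar
  exact (add_pos_of_pos_of_nonneg (pos_iff_ne_zero.2 (var_ne_zero hσ hj)) zero_le).ne'

lemma coe_diffVar (j k : Fin K) :
    (diffVar σ T j k : ℝ) = σ ^ 2 * (1 / T j + 1 / T k) := by
  unfold diffVar
  rw [NNReal.coe_add, Real.coe_toNNReal _ (by positivity), Real.coe_toNNReal _ (by positivity)]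
  ring

lemma posterior_map_sub {j k : Fin K} (hjk : j ≠ k) :
    (posterior σ m T).map (fun θ => θ j - θ k) =
      gaussianReal (m j - m k) (diffVar σ T j k) := by
  have hind : iIndepFun (fun i (θ : Fin K → ℝ) => θ i) (posterior σ m T) :=
    iIndepFun_pi (X := fun _ => id) fun _ => aemeasurable_id
  have hev : ∀ i, (posterior σ m T).map (fun θ => θ i) =
      gaussianReal (m i) (σ ^ 2 / (T i : ℝ)).toNNReal := fun i =>
    (measurePreserving_eval (fun i => gaussianReal (m i) (σ ^ 2 / (T i : ℝ)).toNNReal) i).map_eq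
  have hneg : (posterior σ m T).map (fun θ => -θ k) =
      gaussianReal (-m k) (σ ^ 2 / (T k : ℝ)).toNNReal := by
    rw [← gaussianReal_map_neg, ← hev k, Measure.map_map (by fun_prop) (by fun_prop)]
    rfl
  have := gaussianReal_add_gaussianReal_of_indepFun
    ((hind.indepFun hjk).comp measurable_id measurable_neg) (hev j) hneg
  simpa [sub_eq_add_neg, diffVar] using! this

lemma posterior_real_le (hσ : 0 < σ) {j k : Fin K} (hjk : j ≠ k) (hj : 1 ≤ T j)
    (h : m j ≤ m k) :
    (posterior σ m T).real {θ | θ k ≤ θ j} ≤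
      Real.exp (-((m k - m j) ^ 2 / (2 * diffVar σ T j k))) := by
  have := gaussianReal_real_Ici_le (m j - m k) (diffVar_ne_zero T hσ (k := k) hj)
    (x := 0) (by linarith)
  rw [← posterior_map_sub m T hjk, map_measureReal_apply (by fun_prop) measurableSet_Ici] at this
  convert! this using 3
  · ext θ; simp
  · ring

lemma le_posterior_real (hσ : 0 < σ) {j k : Fin K} (hjk : j ≠ k) (hj : 1 ≤ T j)
    (h : m j ≤ m k) :
    (√(2 * Real.pi))⁻¹ * Real.exp (-((m k - m j) / √(diffVar σ T j k) + 1) ^ 2 / 2) ≤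
      (posterior σ m T).real {θ | θ k < θ j} := by
  have := le_gaussianReal_real_Ioi (m j - m k) (diffVar_ne_zero T hσ (k := k) hj)
    (x := 0) (by linarith)
  rw [← posterior_map_sub m T hjk, map_measureReal_apply (by fun_prop) measurableSet_Ioi] at this
  convert! this using 3
  · ring
  · ext θ; simp

/-- An arm with few observations is optimal with a posterior probability that is bounded below. -/
lemma exists_le_optimalProb (hσ : 0 < σ) (B : ℝ) (N : ℕ) :
    ∃ c : ℝ, 0 < c ∧ ∀ (m : Fin K → ℝ) (T : Fin K → ℕ) (i : Fin K), (∀ j, |m j| ≤ B) →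
      (∀ j, 1 ≤ T j) → T i ≤ N → c ≤ optimalProb (posterior σ m T) i := by
  -- The box where θ i > M and every other coordinate is < M lies in the event. `a` bounds the
  -- factor of `i` from below; each other mean is at least 2σ below M and each variance is at most
  -- σ², so the other factors are at least 1 - exp(-1) ≥ 1/2.
  set M : ℝ := B + 2 * σ with hM
  set a : ℝ := (√(2 * Real.pi))⁻¹ * Real.exp (-((2 * B + 2 * σ) / √(σ ^ 2 / N) + 1) ^ 2 / 2)
  have ha : 0 < a := by positivity
  refine ⟨∏ j : Fin K, min a (1 / 2), Finset.prod_pos fun j _ => by positivity, ?_⟩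
  intro m T i hm hT hTi
  have hvar : ∀ j, (((σ ^ 2 / (T j : ℝ)).toNNReal : NNReal) : ℝ) = σ ^ 2 / T j := fun j =>
    Real.coe_toNNReal _ (by positivity)
  have hTpos : ∀ j, (0 : ℝ) < T j := fun j => by exact_mod_cast hT j
  have hsub : Set.univ.pi (fun j => if j = i then Set.Ioi M else Set.Iio M) ⊆
      {θ : Fin K → ℝ | ∀ j, j ≠ i → θ j < θ i} := by
    intro θ hθ j hj
    have h1 := hθ i trivial
    have h2 := hθ j trivial
    simp only [if_true, hj, if_false, Set.mem_Ioi, Set.mem_Iio] at h1 h2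
    exact h2.trans h1
  refine le_trans ?_ (measureReal_mono hsub)
  rw [posterior, Measure.real, Measure.pi_pi, ENNReal.toReal_prod]
  refine Finset.prod_le_prod (fun j _ => by positivity) fun j _ => ?_
  have hmj := abs_le.1 (hm j)
  split_ifs with hj
  · subst hj
    refine (min_le_left _ _).trans (le_trans ?_
      (le_gaussianReal_real_Ioi (m j) (var_ne_zero hσ (hT j)) (x := M) (by linarith)))
    rw [hvar]
    have h1 : σ ^ 2 / (N : ℝ) ≤ σ ^ 2 / T j := by
      have := hTpos j
      gcongr
    have h0 : 0 < √(σ ^ 2 / (N : ℝ)) := by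
      have : (0 : ℝ) < N := lt_of_lt_of_le (hTpos j) (by exact_mod_cast hTi)
      positivity
    have h2 : (M - m j) / √(σ ^ 2 / (T j : ℝ)) ≤ (2 * B + 2 * σ) / √(σ ^ 2 / (N : ℝ)) := by
      gcongr
      · linarith
      · linarith
    have h3 : 0 ≤ (M - m j) / √(σ ^ 2 / (T j : ℝ)) :=
      div_nonneg (by linarith) (Real.sqrt_nonneg _)
    refine mul_le_mul_of_nonneg_left (Real.exp_le_exp.2 ?_) (by positivity)
    rw [neg_div, neg_div, neg_le_neg_iff]
    gcongr
  · refine (min_le_right _ _).trans ?_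
    change _ ≤ (gaussianReal (m j) _).real (Set.Iio M)
    have h1 := gaussianReal_real_Ici_le (m j) (var_ne_zero hσ (hT j)) (x := M) (by linarith)
    have h2 : (gaussianReal (m j) (σ ^ 2 / (T j : ℝ)).toNNReal).real (Set.Iio M) =
        1 - (gaussianReal (m j) (σ ^ 2 / (T j : ℝ)).toNNReal).real (Set.Ici M) := by
      rw [← probReal_compl_eq_one_sub measurableSet_Ici, Set.compl_Ici]
    rw [hvar] at h1
    have h3 : (1 : ℝ) ≤ (M - m j) ^ 2 / (2 * (σ ^ 2 / T j)) := by
      rw [one_le_div (by have := hTpos j; positivity)]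
      have h4 : σ ^ 2 / (T j : ℝ) ≤ σ ^ 2 := div_le_self (by positivity) (by exact_mod_cast hT j)
      nlinarith [hmj.2]
    have h5 : Real.exp (-((M - m j) ^ 2 / (2 * (σ ^ 2 / T j)))) ≤ 1 / 2 := by
      refine (Real.exp_le_exp.2 (neg_le_neg h3)).trans ?_
      have := Real.exp_one_gt_d9
      rw [Real.exp_neg, inv_le_comm₀ (Real.exp_pos 1) (by norm_num)]
      linarith
    linarith

end Posterior

lemma one_sub_optimalProb_le_sum {K : ℕ} (Q : Measure (Fin K → ℝ)) [IsProbabilityMeasure Q]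
    (i : Fin K) :
    1 - optimalProb Q i ≤ ∑ j ∈ Finset.univ.erase i, Q.real {θ | θ i ≤ θ j} := by
  have hm : MeasurableSet {θ : Fin K → ℝ | ∀ j, j ≠ i → θ j < θ i} := by
    rw [Set.ofPred_forall]
    refine MeasurableSet.iInter fun j => ?_
    by_cases hj : j = i
    · simp [hj]
    · simpa [hj] using! measurableSet_lt (measurable_pi_apply j) (measurable_pi_apply i)
  have hsub : {θ : Fin K → ℝ | ∀ j, j ≠ i → θ j < θ i}ᶜ ⊆
      ⋃ j ∈ Finset.univ.erase i, {θ | θ i ≤ θ j} := by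
    intro θ hθ
    have : ∃ j, j ≠ i ∧ θ i ≤ θ j := by
      by_contra! h
      exact hθ h
    obtain ⟨j, hj, h⟩ := this
    exact Set.mem_biUnion (Finset.mem_coe.2 (Finset.mem_erase.2 ⟨hj, Finset.mem_univ j⟩)) h
  calc 1 - optimalProb Q i = Q.real {θ : Fin K → ℝ | ∀ j, j ≠ i → θ j < θ i}ᶜ := by
        rw [probReal_compl_eq_one_sub hm]; rfl
    _ ≤ Q.real (⋃ j ∈ Finset.univ.erase i, {θ | θ i ≤ θ j}) :=
        measureReal_mono hsub (measure_ne_top _ _)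
    _ ≤ _ := measureReal_biUnion_finset_le _ _

/-! ### Play probabilities in one top-two step -/

section Step

variable {K : ℕ} [NeZero K]

lemma argmaxArm_eq_iff (θ : Fin K → ℝ) (i : Fin K) :
    argmaxArm θ = i ↔ (∀ j, θ j ≤ θ i) ∧ ∀ k, (∀ j, θ j ≤ θ k) → i ≤ k := by
  unfold argmaxArm
  rw [Finset.min'_eq_iff]
  simp

lemma le_argmaxArm (θ : Fin K → ℝ) (j : Fin K) : θ j ≤ θ (argmaxArm θ) :=
  ((argmaxArm_eq_iff θ _).1 rfl).1 j

lemma argmaxArm_eq_of_forall_lt {θ : Fin K → ℝ} {i : Fin K} (h : ∀ j, j ≠ i → θ j < θ i) :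
    argmaxArm θ = i := by
  by_contra hne
  exact absurd (h _ hne) (not_lt.2 (le_argmaxArm θ i))

lemma measurable_argmaxArm : Measurable (argmaxArm : (Fin K → ℝ) → Fin K) := by
  refine measurable_to_countable' fun i => ?_
  have : argmaxArm ⁻¹' {i} =
      {θ : Fin K → ℝ | (∀ j, θ j ≤ θ i) ∧ ∀ k, (∀ j, θ j ≤ θ k) → i ≤ k} := by
    ext θ; exact argmaxArm_eq_iff θ i
  rw [this]
  have hm : ∀ i, MeasurableSet {θ : Fin K → ℝ | ∀ j, θ j ≤ θ i} := fun i => by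
    rw [Set.ofPred_forall]
    exact MeasurableSet.iInter fun j => measurableSet_le (measurable_pi_apply j)
      (measurable_pi_apply i)
  have hm' : MeasurableSet {θ : Fin K → ℝ | ∀ k, (∀ j, θ j ≤ θ k) → i ≤ k} := ?_
  · exact (hm i).inter hm'
  rw [Set.ofPred_forall]
  refine MeasurableSet.iInter fun k => ?_
  by_cases hk : i ≤ k
  · simp [hk]
  · simp only [hk, imp_false]
    exact (hm k).compl

variable (Q : Measure (Fin K → ℝ))

/-- The probability that arm `i` is the best arm of a sample from `Q`. -/
noncomputable def armProb (i : Fin K) : ℝ := Q.real {θ | argmaxArm θ = i}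

lemma measurableSet_argmaxArm_eq (i : Fin K) :
    MeasurableSet {θ : Fin K → ℝ | argmaxArm θ = i} :=
  measurable_argmaxArm (measurableSet_singleton i)

lemma armProb_nonneg (i : Fin K) : 0 ≤ armProb Q i := measureReal_nonneg

variable [IsProbabilityMeasure Q]

lemma optimalProb_le_armProb (i : Fin K) : optimalProb Q i ≤ armProb Q i :=
  measureReal_mono fun _ h => argmaxArm_eq_of_forall_lt h

lemma armProb_le_real {i k : Fin K} : armProb Q i ≤ Q.real {θ | θ k ≤ θ i} :=
  measureReal_mono fun θ (h : argmaxArm θ = i) => by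
    simpa [h] using! le_argmaxArm θ k

lemma one_sub_armProb (i : Fin K) : 1 - armProb Q i = Q.real {θ | argmaxArm θ ≠ i} := by
  rw [armProb, ← probReal_compl_eq_one_sub (measurableSet_argmaxArm_eq i)]
  rfl

lemma real_lt_le_one_sub_armProb (i j : Fin K) :
    Q.real {θ | θ i < θ j} ≤ 1 - armProb Q i := by
  rw [one_sub_armProb]
  refine measureReal_mono fun θ (h : θ i < θ j) hi => ?_
  have := le_argmaxArm θ j
  rw [show argmaxArm θ = i from hi] at this
  exact absurd h (not_lt.2 this)

lemma one_sub_armProb_le_one_sub_optimalProb (i : Fin K) :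
    1 - armProb Q i ≤ 1 - optimalProb Q i :=
  sub_le_sub_left (optimalProb_le_armProb Q i) 1

/-- Serves to split the law of the challenger according to the number `n` of rejected samples. -/
lemma infinitePi_argmaxArm_forall_lt_and (i j : Fin K) (n : ℕ) :
    Measure.infinitePi (fun _ : ℕ => Q)
        {θ' | (∀ l < n, argmaxArm (θ' l) = j) ∧ argmaxArm (θ' n) = i} =
      Q {θ | argmaxArm θ = j} ^ n * Q {θ | argmaxArm θ = i} := by
  have : {θ' : ℕ → Fin K → ℝ | (∀ l < n, argmaxArm (θ' l) = j) ∧ argmaxArm (θ' n) = i} =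
      Set.pi (Finset.range (n + 1))
        (fun l => if l < n then {θ | argmaxArm θ = j} else {θ | argmaxArm θ = i}) := by
    ext θ'
    simp only [Set.mem_ofPred_eq, Set.mem_pi, Finset.coe_range, Set.mem_Iio]
    constructor
    · rintro ⟨h1, h2⟩ l hl
      split_ifs with h
      · exact h1 l h
      · obtain rfl : l = n := by omega
        exact h2
    · intro h
      refine ⟨fun l hl => ?_, ?_⟩
      · simpa [hl] using! h l (by omega)
      · simpa using! h n (by omega)
  rw [this, Measure.infinitePi_pi]
  · rw [Finset.prod_range_succ, Finset.prod_congr rfl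
      (g := fun _ => Q {θ | argmaxArm θ = j})
      (fun l hl => by rw [if_pos (Finset.mem_range.1 hl)])]
    simp
  · intro l _
    split_ifs
    · exact measurableSet_argmaxArm_eq j
    · exact measurableSet_argmaxArm_eq i

/-- With leader `j`, resampling rejects every `j`; summing α_j ^ n * α_i over the number of
rejections is a geometric series. The probability of the leader itself is bounded by 1. -/
lemma prod_challenger_eq_le (i : Fin K) {j : Fin K} (hj : armProb Q j < 1) :
    (Q.prod (Measure.infinitePi fun _ : ℕ => Q)).real
        {p | argmaxArm p.1 = j ∧ challenger p.1 p.2 = i} ≤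
      armProb Q i / (1 - armProb Q j) := by
  set R := Measure.infinitePi fun _ : ℕ => Q
  set E : ℕ → Set (ℕ → Fin K → ℝ) := fun n =>
    {θ' | (∀ l < n, argmaxArm (θ' l) = j) ∧ argmaxArm (θ' n) = i}
  have hsub : {p : (Fin K → ℝ) × (ℕ → Fin K → ℝ) |
      argmaxArm p.1 = j ∧ challenger p.1 p.2 = i} ⊆ Set.univ ×ˢ ⋃ n, E n := by
    rintro ⟨θ, θ'⟩ ⟨h1, h2⟩
    refine ⟨trivial, Set.mem_iUnion.2 ⟨sInf {m : ℕ | argmaxArm (θ' m) ≠ argmaxArm θ}, ?_, h2⟩⟩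
    intro l hl
    have := Nat.notMem_of_lt_sInf hl
    simpa [show argmaxArm θ = j from h1] using! this
  have hα : ∀ k, Q {θ | argmaxArm θ = k} = ENNReal.ofReal (armProb Q k) := fun k => by
    rw [armProb, ofReal_measureReal]
  have hle : (Q.prod R) {p | argmaxArm p.1 = j ∧ challenger p.1 p.2 = i} ≤
      ENNReal.ofReal (armProb Q i / (1 - armProb Q j)) := by
    calc (Q.prod R) {p | argmaxArm p.1 = j ∧ challenger p.1 p.2 = i}
        ≤ (Q.prod R) (Set.univ ×ˢ ⋃ n, E n) := measure_mono hsub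
      _ = R (⋃ n, E n) := by rw [Measure.prod_prod]; simp
      _ ≤ ∑' n, R (E n) := measure_iUnion_le _
      _ = ∑' n, Q {θ | argmaxArm θ = j} ^ n * Q {θ | argmaxArm θ = i} := by
          congr 1; ext n; exact infinitePi_argmaxArm_forall_lt_and Q i j n
      _ = ENNReal.ofReal (armProb Q i / (1 - armProb Q j)) := by
          rw [ENNReal.tsum_mul_right, ENNReal.tsum_geometric, hα, hα,
            ← ENNReal.ofReal_one, ← ENNReal.ofReal_sub _ (armProb_nonneg Q j),
            ← ENNReal.ofReal_inv_of_pos (by linarith),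
            ← ENNReal.ofReal_mul (by rw [inv_nonneg]; linarith)]
          congr 1
          rw [div_eq_inv_mul]
  exact ENNReal.toReal_le_of_le_ofReal
    (div_nonneg (armProb_nonneg Q i) (by linarith)) hle

/-- A challenger equal to the leader can occur only when resampling never stops, where `sInf ∅ = 0`
makes `challenger` return a default value. Then all samples have best arm `j`, an event of
probability at most α_j ^ n for every n. -/
lemma prod_challenger_eq_self {j : Fin K} (hj : armProb Q j < 1) :
    (Q.prod (Measure.infinitePi fun _ : ℕ => Q)).real
        {p | argmaxArm p.1 = j ∧ challenger p.1 p.2 = j} = 0 := by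
  set R := Measure.infinitePi fun _ : ℕ => Q
  have hQ : Q {θ | argmaxArm θ = j} < 1 := by
    rw [← ofReal_measureReal (μ := Q)]
    exact ENNReal.ofReal_lt_one.2 hj
  have hle : ∀ n : ℕ, (Q.prod R) {p | argmaxArm p.1 = j ∧ challenger p.1 p.2 = j} ≤
      Q {θ | argmaxArm θ = j} ^ n := by
    intro n
    calc (Q.prod R) {p | argmaxArm p.1 = j ∧ challenger p.1 p.2 = j}
        ≤ (Q.prod R) (Set.univ ×ˢ
          {θ' | (∀ l < n, argmaxArm (θ' l) = j) ∧ argmaxArm (θ' n) = j}) := by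
          refine measure_mono ?_
          rintro ⟨θ, θ'⟩ ⟨h1, h2⟩
          simp only at h1 h2
          have hall : ∀ m, argmaxArm (θ' m) = j := by
            by_contra! hne
            have := Nat.sInf_mem (s := {m : ℕ | argmaxArm (θ' m) ≠ argmaxArm θ})
              (by rw [h1]; exact hne)
            exact this (h2.trans h1.symm)
          exact ⟨trivial, fun l _ => hall l, hall n⟩
      _ = Q {θ | argmaxArm θ = j} ^ n * Q {θ | argmaxArm θ = j} := by
          rw [Measure.prod_prod, infinitePi_argmaxArm_forall_lt_and]; simp
      _ ≤ Q {θ | argmaxArm θ = j} ^ n := mul_le_of_le_one_right' prob_le_one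
  have : (Q.prod R) {p | argmaxArm p.1 = j ∧ challenger p.1 p.2 = j} = 0 :=
    le_antisymm (ge_of_tendsto' (ENNReal.tendsto_pow_atTop_nhds_zero_of_lt_one hQ) hle) zero_le
  simp [Measure.real, this]

lemma prod_argmaxArm_ne (j : Fin K) :
    (Q.prod (Measure.infinitePi fun _ : ℕ => Q)).real {p | argmaxArm p.1 ≠ j} =
      1 - armProb Q j := by
  have : {p : (Fin K → ℝ) × (ℕ → Fin K → ℝ) | argmaxArm p.1 ≠ j} =
      {θ | argmaxArm θ ≠ j} ×ˢ Set.univ := by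
    ext p; simp
  rw [this, measureReal_prod_prod, one_sub_armProb]
  simp

variable {β : ℝ}

lemma mul_armProb_le_stepProb (hβ₁ : β < 1) (i : Fin K) :
    β * armProb Q i ≤ stepProb β Q i :=
  le_add_of_nonneg_right (mul_nonneg (by linarith) measureReal_nonneg)

lemma stepProb_le_one (hβ₀ : 0 < β) (hβ₁ : β < 1) (i : Fin K) : stepProb β Q i ≤ 1 := by
  have h1 : β * Q.real {θ | argmaxArm θ = i} ≤ β :=
    mul_le_of_le_one_right hβ₀.le measureReal_le_one
  have h2 : (1 - β) * (Q.prod (Measure.infinitePi fun _ : ℕ => Q)).real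
      {p | challenger p.1 p.2 = i} ≤ 1 - β :=
    mul_le_of_le_one_right (by linarith) measureReal_le_one
  unfold stepProb
  linarith

/-- The three terms cover these cases: `i` is the leader; the leader is not `j`; the leader is `j`
and `i` is its challenger. -/
lemma stepProb_le_of_ne (hβ₀ : 0 < β) (hβ₁ : β < 1) (i : Fin K) {j : Fin K}
    (hj : armProb Q j < 1) :
    stepProb β Q i ≤
      armProb Q i + (1 - armProb Q j) + armProb Q i / (1 - armProb Q j) := by
  have h1 : (Q.prod (Measure.infinitePi fun _ : ℕ => Q)).real {p | challenger p.1 p.2 = i} ≤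
      (1 - armProb Q j) + armProb Q i / (1 - armProb Q j) := by
    refine le_trans (le_trans (measureReal_mono ?_) (measureReal_union_le _ _))
      (add_le_add (prod_argmaxArm_ne Q j).le (prod_challenger_eq_le Q i hj))
    intro p hp
    by_cases h : argmaxArm p.1 = j
    · exact Or.inr ⟨h, hp⟩
    · exact Or.inl h
  have h2 := armProb_nonneg Q i
  have h3 : 0 ≤ (1 - armProb Q j) + armProb Q i / (1 - armProb Q j) :=
    measureReal_nonneg.trans h1
  have h4 : (1 - β) * (Q.prod (Measure.infinitePi fun _ : ℕ => Q)).real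
      {p | challenger p.1 p.2 = i} ≤ (1 - armProb Q j) + armProb Q i / (1 - armProb Q j) :=
    (mul_le_of_le_one_left measureReal_nonneg (by linarith)).trans h1
  have h5 : β * armProb Q i ≤ armProb Q i := mul_le_of_le_one_left h2 hβ₁.le
  change β * armProb Q i + _ ≤ _
  linarith

/-- Almost surely `j` is never its own challenger, so it is played as the leader, or as a challenger
to another leader. -/
lemma stepProb_le_self (hβ₀ : 0 < β) {j : Fin K} (hj : armProb Q j < 1) :
    stepProb β Q j ≤ β + (1 - armProb Q j) := by
  have h1 : (Q.prod (Measure.infinitePi fun _ : ℕ => Q)).real {p | challenger p.1 p.2 = j} ≤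
      1 - armProb Q j := by
    refine le_trans (le_trans (measureReal_mono ?_) (measureReal_union_le _ _))
      ((add_le_add (prod_argmaxArm_ne Q j).le (prod_challenger_eq_self Q hj).le).trans_eq
        (add_zero _))
    intro p hp
    by_cases h : argmaxArm p.1 = j
    · exact Or.inr ⟨h, hp⟩
    · exact Or.inl h
  have h4 : (1 - β) * (Q.prod (Measure.infinitePi fun _ : ℕ => Q)).real
      {p | challenger p.1 p.2 = j} ≤ 1 - armProb Q j :=
    (mul_le_of_le_one_left measureReal_nonneg (by linarith)).trans h1
  have h5 : β * armProb Q j ≤ β := mul_le_of_le_one_right hβ₀.le hj.le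
  change β * armProb Q j + _ ≤ _
  linarith

end Step

/-! ### Counts of plays and measurability with respect to the history -/

section Counting

variable {K : ℕ} {Ω : Type*} (I : ℕ → Ω → Fin K)

lemma pulls_zero (ω : Ω) (i : Fin K) : pulls I 0 ω i = 0 := by simp [pulls]

lemma pulls_one (ω : Ω) (i : Fin K) : pulls I 1 ω i = 0 := by simp [pulls]

lemma pulls_succ {n : ℕ} (hn : 1 ≤ n) (ω : Ω) (i : Fin K) :
    pulls I (n + 1) ω i = pulls I n ω i + if I n ω = i then 1 else 0 := by
  unfold pulls
  rw [← Finset.insert_Ico_right_eq_Ico_add_one hn, Finset.filter_insert]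
  split_ifs with h
  · rw [Finset.card_insert_of_notMem (by simp)]
  · simp

lemma pulls_mono (ω : Ω) (i : Fin K) : Monotone fun n => pulls I n ω i := fun _ _ hab =>
  Finset.card_le_card (Finset.filter_subset_filter _ (Finset.Ico_subset_Ico le_rfl hab))

lemma pulls_eq_sum (n : ℕ) (ω : Ω) (i : Fin K) :
    pulls I n ω i = ∑ l ∈ Finset.Ico 1 n, if I l ω = i then 1 else 0 := by
  unfold pulls; rw [Finset.card_filter]

lemma sum_pulls (n : ℕ) (ω : Ω) : ∑ i, pulls I n ω i = n - 1 := by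
  simp only [pulls_eq_sum]
  rw [Finset.sum_comm]
  simp

/-- Telescoping along the plays of `i`, by 1/(t+1)² ≤ 2/(t+1) - 2/(t+2). The bound is uniform over
paths and controls the second moments of the reward martingale. -/
lemma sum_inv_sq_le (ω : Ω) (i : Fin K) (n : ℕ) :
    ∑ l ∈ Finset.range n,
      (if 1 ≤ l ∧ I l ω = i then (1 : ℝ) / (pulls I l ω i + 1) else 0) ^ 2 ≤
      2 - 2 / (pulls I n ω i + 1) := by
  induction n with
  | zero => simp [pulls_zero]
  | succ n ih =>
    rw [Finset.sum_range_succ]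
    rcases Nat.eq_zero_or_pos n with rfl | (hn : 1 ≤ n)
    · simp [pulls_one]
    · rw [pulls_succ I hn]
      by_cases h : I n ω = i
      · simp only [hn, h, and_self, if_true]
        set t : ℝ := (pulls I n ω i : ℝ) with ht
        have ht0 : 0 ≤ t := Nat.cast_nonneg _
        push_cast
        rw [← ht]
        have : (1 / (t + 1)) ^ 2 ≤ 2 / (t + 1) - 2 / (t + 1 + 1) := by
          rw [div_sub_div _ _ (by positivity) (by positivity), div_pow,
            div_le_div_iff₀ (by positivity) (by positivity)]
          nlinarith
        linarith
      · simp only [h, and_false, if_false, add_zero]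
        simpa using ih

end Counting

section Measurability

variable {K : ℕ} {Ω : Type*} {I : ℕ → Ω → Fin K} {Y : ℕ → Ω → Fin K → ℝ}

lemma history_mono : Monotone (history I Y) := fun _ _ hab =>
  biSup_mono fun _ hl => Finset.Ico_subset_Ico le_rfl hab hl

lemma measurable_observation {l n : ℕ} (hl : 1 ≤ l) (hln : l < n) :
    Measurable[history I Y n] (fun ω => (I l ω, Y l ω (I l ω))) :=
  Measurable.mono (comap_measurable _)
    (le_iSup₂_of_le (f := fun l (_ : l ∈ Finset.Ico 1 n) =>
      MeasurableSpace.comap (fun ω => (I l ω, Y l ω (I l ω))) inferInstance)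
      l (Finset.mem_Ico.2 ⟨hl, hln⟩) le_rfl) le_rfl

lemma measurable_arm_history {l n : ℕ} (hl : 1 ≤ l) (hln : l < n) :
    Measurable[history I Y n] (I l) :=
  measurable_fst.comp (measurable_observation hl hln)

lemma measurable_pulls {n : ℕ} (i : Fin K) :
    Measurable[history I Y n] (fun ω => (pulls I n ω i : ℝ)) := by
  simp only [pulls_eq_sum]
  push_cast
  refine Finset.measurable_fun_sum _ fun l hl => ?_
  have hl' := Finset.mem_Ico.1 hl
  refine Measurable.ite ?_ measurable_const measurable_const
  exact measurable_arm_history hl'.1 hl'.2 (measurableSet_singleton i)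

end Measurability

/-! ### Almost sure laws of large numbers -/

namespace IsTTTS

variable {K : ℕ} [NeZero K] {Ω : Type*} [mΩ : MeasurableSpace Ω] {P : Measure Ω}
  {σ : ℝ} {μ : Fin K → ℝ} {β : ℝ} {I : ℕ → Ω → Fin K} {Y : ℕ → Ω → Fin K → ℝ}

lemma measurable_reward_arm (h : IsTTTS P σ μ β I Y) {l : ℕ} (hl : 1 ≤ l) :
    Measurable fun ω => Y l ω (I l ω) := by
  have : (fun ω => Y l ω (I l ω)) = fun ω => ∑ i, if I l ω = i then Y l ω i else 0 := by
    ext ω; simp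
  rw [this]
  refine Finset.measurable_fun_sum _ fun i _ => Measurable.ite ?_ ?_ measurable_const
  · exact h.measurable_arm l hl (measurableSet_singleton i)
  · exact (measurable_pi_apply i).comp (h.measurable_reward l hl)

lemma history_le (h : IsTTTS P σ μ β I Y) (n : ℕ) : history I Y n ≤ mΩ := by
  refine iSup₂_le fun l hl => ?_
  have hl' := (Finset.mem_Ico.1 hl).1
  exact ((h.measurable_arm l hl').prodMk (h.measurable_reward_arm hl')).comap_le

/-- The filtration of the histories. -/
def filtration (h : IsTTTS P σ μ β I Y) : Filtration ℕ mΩ where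
  seq := history I Y
  mono' := history_mono
  le' := h.history_le

variable [IsProbabilityMeasure P]

/-- The noise of the observed rewards of arm `i`, divided by the number of observations, is
almost surely summable. -/
lemma ae_exists_tendsto_sum_reward (h : IsTTTS P σ μ β I Y) (i : Fin K) :
    ∀ᵐ ω ∂P, ∃ s, Tendsto (fun n => ∑ l ∈ Finset.range n,
      (if 1 ≤ l ∧ I l ω = i then (1 : ℝ) / (pulls I l ω i + 1) else 0) * (Y l ω i - μ i))
      atTop (𝓝 s) := by
  set W : ℕ → Ω → ℝ := fun l ω =>
    if 1 ≤ l ∧ I l ω = i then (1 : ℝ) / (pulls I l ω i + 1) else 0 with hW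
  set X : ℕ → Ω → ℝ := fun l ω => Y l ω i - μ i with hX
  have hW0 : ∀ ω, W 0 ω = 0 := fun ω => by simp [hW]
  have hW01 : ∀ l ω, 0 ≤ W l ω ∧ W l ω ≤ 1 := by
    intro l ω
    simp only [hW]
    split_ifs
    · refine ⟨by positivity, ?_⟩
      rw [div_le_one (by positivity)]
      have : (0 : ℝ) ≤ pulls I l ω i := Nat.cast_nonneg _
      linarith
    · simp
  -- The weight `W l` depends on the arm of round `l`, so it is not measurable for the history.
  -- Adding that arm to the σ-algebra makes it measurable while `Y l` stays independent; the tower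
  -- property then returns to the history.
  set 𝒢 : ℕ → MeasurableSpace Ω := fun l =>
    history I Y l ⊔ MeasurableSpace.comap (I l) inferInstance with h𝒢
  have h𝒢le : ∀ l, 1 ≤ l → 𝒢 l ≤ mΩ := fun l hl =>
    sup_le (h.history_le l) (h.measurable_arm l hl).comap_le
  have hWm : ∀ l, 1 ≤ l → Measurable[𝒢 l] (W l) := by
    intro l hl
    have h1 : Measurable[𝒢 l] (I l) :=
      Measurable.mono (comap_measurable (I l)) le_sup_right le_rfl
    have h2 : Measurable[𝒢 l] (fun ω => (pulls I l ω i : ℝ)) :=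
      (measurable_pulls (Y := Y) i).mono le_sup_left le_rfl
    simp only [hW, hl, true_and]
    refine Measurable.ite (h1 (measurableSet_singleton i)) ?_ measurable_const
    exact measurable_const.div (h2.add measurable_const)
  have hXm : ∀ l, Measurable[MeasurableSpace.comap (Y l) inferInstance] (X l) := fun l =>
    ((measurable_pi_apply i).comp (comap_measurable (Y l))).sub measurable_const
  have hXm' : ∀ l, 1 ≤ l → Measurable (X l) := fun l hl =>
    (hXm l).mono (h.measurable_reward l hl).comap_le le_rfl
  have hYm : ∀ l, 1 ≤ l → Measurable fun ω => Y l ω i := fun l hl =>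
    (measurable_pi_apply i).comp (h.measurable_reward l hl)
  have hX2 : ∀ l, 1 ≤ l → MemLp (X l) 2 P := by
    intro l hl
    have h1 : MemLp (fun x : ℝ => x - μ i) 2 (P.map fun ω => Y l ω i) := by
      rw [h.law_reward l hl i]
      exact (memLp_id_gaussianReal' 2 (by norm_num)).sub (memLp_const (μ i))
    exact h1.comp_of_map (hYm l hl).aemeasurable
  have hXint : ∀ l, 1 ≤ l → ∫ ω, X l ω ∂P = 0 := by
    intro l hl
    have h1 : ∫ x, (x - μ i) ∂(P.map fun ω => Y l ω i) = 0 := by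
      rw [h.law_reward l hl i, integral_sub, integral_id_gaussianReal]
      · simp
      · exact (memLp_id_gaussianReal' 1 (by norm_num)).integrable le_rfl
      · exact integrable_const _
    rwa [integral_map (hYm l hl).aemeasurable (by fun_prop)] at h1
  set c : ℝ := ∫ x, (x - μ i) ^ 2 ∂(gaussianReal (μ i) (σ ^ 2).toNNReal) with hc
  have hc0 : 0 ≤ c := integral_nonneg fun x => sq_nonneg _
  have hXsq : ∀ l, 1 ≤ l → ∫ ω, X l ω ^ 2 ∂P = c := by
    intro l hl
    rw [hc, ← h.law_reward l hl i, integral_map (hYm l hl).aemeasurable (by fun_prop)]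
  have hWm' : ∀ l, Measurable (W l) := by
    intro l
    rcases Nat.eq_zero_or_pos l with rfl | (hl : 1 ≤ l)
    · rw [funext hW0]; exact measurable_const
    · exact (hWm l hl).mono (h𝒢le l hl) le_rfl
  have hD2 : ∀ l, MemLp (W l * X l) 2 P := by
    intro l
    rcases Nat.eq_zero_or_pos l with rfl | (hl : 1 ≤ l)
    · have : W 0 * X 0 = 0 := by ext ω; simp [hW0]
      rw [this]; exact MemLp.zero'
    · refine (hX2 l hl).of_le ((hWm' l).mul (hXm' l hl)).aestronglyMeasurable
        (Eventually.of_forall fun ω => ?_)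
      rw [Pi.mul_apply, norm_mul]
      refine mul_le_of_le_one_left (norm_nonneg _) ?_
      rw [Real.norm_of_nonneg (hW01 l ω).1]
      exact (hW01 l ω).2
  refine ae_exists_tendsto_sum_of_sq_bdd h.filtration (fun l => W l * X l) ?_ hD2 ?_ (c * 2) ?_
  · intro l
    rcases Nat.eq_zero_or_pos l with rfl | (hl : 1 ≤ l)
    · have : W 0 * X 0 = 0 := by ext ω; simp [hW0]
      rw [this]; exact stronglyMeasurable_zero
    -- The reward of `i` has nonzero weight only when it is observed, which makes the product
    -- adapted to the next history.
    · have : W l * X l = fun ω => if I l ω = i then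
          (1 : ℝ) / (pulls I l ω i + 1) * (Y l ω (I l ω) - μ i) else 0 := by
        ext ω
        simp only [hW, hX, Pi.mul_apply, hl, true_and]
        split_ifs with hi
        · rw [hi]
        · simp
      rw [this]
      refine Measurable.stronglyMeasurable ?_
      change Measurable[history I Y (l + 1)] _
      refine Measurable.ite
        (measurable_arm_history hl (Nat.lt_succ_self l) (measurableSet_singleton i)) ?_
        measurable_const
      have h2 : Measurable[history I Y (l + 1)] (fun ω => (pulls I l ω i : ℝ)) :=
        (measurable_pulls (Y := Y) i).mono (history_mono (Nat.le_succ l)) le_rfl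
      have h3 : Measurable[history I Y (l + 1)] (fun ω => Y l ω (I l ω)) :=
        measurable_snd.comp (measurable_observation hl (Nat.lt_succ_self l))
      exact (measurable_const.div (h2.add measurable_const)).mul (h3.sub measurable_const)
  · intro l
    rcases Nat.eq_zero_or_pos l with rfl | (hl : 1 ≤ l)
    · have : W 0 * X 0 = 0 := by ext ω; simp [hW0]
      rw [this, condExp_zero]
    · have hle : history I Y l ≤ 𝒢 l := le_sup_left
      have h1 : P[W l * X l | 𝒢 l] =ᵐ[P] 0 := by
        refine (condExp_mul_of_stronglyMeasurable_left (hWm l hl).stronglyMeasurable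
          ((hD2 l).integrable (by norm_num)) ((hX2 l hl).integrable (by norm_num))).trans ?_
        have h2 := condExp_indep_eq (h.measurable_reward l hl).comap_le (h𝒢le l hl)
          (hXm l).stronglyMeasurable (h.indep_reward l hl)
        filter_upwards [h2] with ω hω
        rw [Pi.mul_apply, hω, hXint l hl]; simp
      have h3 := condExp_condExp_of_le (f := W l * X l) (μ := P) hle (h𝒢le l hl)
      have h4 := condExp_congr_ae (m := history I Y l) h1
      change P[W l * X l | history I Y l] =ᵐ[P] 0
      refine h3.symm.trans (h4.trans ?_)
      rw [condExp_zero]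
  · intro n
    have hW2int : ∀ l, Integrable (fun ω => W l ω ^ 2) P := fun l =>
      Integrable.of_bound ((hWm' l).pow_const 2).aestronglyMeasurable 1
        (Eventually.of_forall fun ω => by
          rw [Real.norm_of_nonneg (sq_nonneg _)]
          exact pow_le_one₀ (hW01 l ω).1 (hW01 l ω).2)
    have h1 : ∀ l, ∫ ω, (W l * X l) ω ^ 2 ∂P = c * ∫ ω, W l ω ^ 2 ∂P := by
      intro l
      rcases Nat.eq_zero_or_pos l with rfl | (hl : 1 ≤ l)
      · simp [hW0]
      · have hind : IndepFun (fun ω => W l ω ^ 2) (fun ω => X l ω ^ 2) P := by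
          rw [IndepFun_iff_Indep]
          refine indep_of_indep_of_le_left (indep_of_indep_of_le_right
            (h.indep_reward l hl).symm ?_) ?_
          · exact ((hXm l).pow_const 2).comap_le
          · exact ((hWm l hl).pow_const 2).comap_le
        have h2 := hind.integral_mul_eq_mul_integral
          ((hWm' l).pow_const 2).aestronglyMeasurable
          ((hXm' l hl).pow_const 2).aestronglyMeasurable
        rw [hXsq l hl, mul_comm (∫ ω, W l ω ^ 2 ∂P)] at h2
        rw [← h2]
        congr 1
        ext ω
        simp [mul_pow]
    simp only [h1]
    rw [← Finset.mul_sum, ← integral_finsetSum _ fun l _ => hW2int l]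
    refine mul_le_mul_of_nonneg_left ?_ hc0
    calc ∫ ω, ∑ l ∈ Finset.range n, W l ω ^ 2 ∂P ≤ ∫ _, (2 : ℝ) ∂P := by
          refine integral_mono (integrable_finsetSum _ fun l _ => hW2int l)
            (integrable_const _) fun ω => ?_
          refine (sum_inv_sq_le I ω i n).trans ?_
          have : 0 ≤ 2 / ((pulls I n ω i : ℝ) + 1) := by positivity
          linarith
      _ = 2 := by simp

/-- The empirical mean of an arm that is played infinitely often is consistent. -/
lemma ae_tendsto_empMean (h : IsTTTS P σ μ β I Y) :
    ∀ᵐ ω ∂P, ∀ i, Tendsto (fun n => pulls I n ω i) atTop atTop →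
      Tendsto (fun n => empMean I Y n ω i) atTop (𝓝 (μ i)) := by
  rw [ae_all_iff]
  intro i
  filter_upwards [h.ae_exists_tendsto_sum_reward i] with ω ⟨s, hs⟩ hT
  have hT' : Tendsto (fun n => (pulls I n ω i : ℝ)) atTop atTop :=
    tendsto_natCast_atTop_atTop.comp hT
  have hmono : Monotone fun n => (pulls I n ω i : ℝ) := fun a b hab =>
    Nat.cast_le.2 (pulls_mono I ω i hab)
  -- With the number of plays as `b`, the factor `b (l + 1)` cancels the weight 1 / (pulls + 1) at
  -- each play of `i`, leaving the plain sum of the centred rewards.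
  have hk := tendsto_sum_mul_sub_div hmono hT' hs
  rw [← tendsto_sub_nhds_zero_iff]
  refine hk.congr' ?_
  filter_upwards [hT'.eventually_gt_atTop 0] with n hn
  rw [empMean, div_sub' hn.ne', div_left_inj' hn.ne']
  have e1 : ∀ l, ((pulls I (l + 1) ω i : ℝ)) *
      ((if 1 ≤ l ∧ I l ω = i then (1 : ℝ) / (pulls I l ω i + 1) else 0) * (Y l ω i - μ i)) =
      if 1 ≤ l ∧ I l ω = i then Y l ω i - μ i else 0 := by
    intro l
    split_ifs with hl
    · rw [pulls_succ I hl.1, if_pos hl.2]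
      push_cast
      have : (pulls I l ω i : ℝ) + 1 ≠ 0 := by positivity
      field_simp
    · simp
  simp only [Finset.sum_range_succ_sub_sum, e1]
  have e2 : ∀ N, ∑ l ∈ Finset.range N, (if 1 ≤ l ∧ I l ω = i then Y l ω i - μ i else 0) =
      ∑ l ∈ Finset.Ico 1 N, (if I l ω = i then Y l ω (I l ω) else 0) -
        (pulls I N ω i : ℝ) * μ i := by
    intro N
    induction N with
    | zero => simp [pulls_zero]
    | succ N ih =>
      rw [Finset.sum_range_succ, ih]
      rcases Nat.eq_zero_or_pos N with rfl | (hN : 1 ≤ N)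
      · simp [pulls_zero, pulls_one]
      · rw [Finset.sum_Ico_succ_top hN, pulls_succ I hN]
        by_cases hi : I N ω = i
        · simp only [hN, hi, and_self, if_true]
          push_cast
          ring
        · simp [hi]
  exact e2 n

/-- The proportion of the rounds in which an arm is played is asymptotically the average of the
conditional probabilities of playing it. -/
lemma ae_tendsto_pulls_sub_sum (h : IsTTTS P σ μ β I Y) :
    ∀ᵐ ω ∂P, ∀ i, ∃ φ : ℕ → ℝ,
      (∀ l, K < l → φ l = stepProb β (posteriorAt σ I Y l ω) i) ∧
      Tendsto (fun n : ℕ => ((pulls I n ω i : ℝ) - ∑ l ∈ Finset.range n, φ l) / n)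
        atTop (𝓝 0) := by
  rw [ae_all_iff]
  intro i
  set A : ℕ → Ω → ℝ := fun l =>
    if 1 ≤ l then (I l ⁻¹' {i}).indicator (fun _ => (1 : ℝ)) else 0 with hA
  -- The weights 1 / (l + 1) make the second moments summable; Kronecker's lemma with `b n = n`
  -- removes them at the end.
  set D : ℕ → Ω → ℝ := fun l => (1 / ((l : ℝ) + 1)) • (A l - P[A l | history I Y l]) with hD
  have hA01 : ∀ l ω, 0 ≤ A l ω ∧ A l ω ≤ 1 := by
    intro l ω
    simp only [hA]
    split_ifs
    · by_cases hi : ω ∈ I l ⁻¹' {i} <;> simp [hi]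
    · simp
  have hAm : ∀ l, Measurable[history I Y (l + 1)] (A l) := by
    intro l
    simp only [hA]
    split_ifs with hl
    · refine Measurable.indicator (m := history I Y (l + 1)) measurable_const ?_
      exact measurable_arm_history hl (Nat.lt_succ_self l) (measurableSet_singleton i)
    · exact @measurable_const _ _ _ (history I Y (l + 1)) 0
  have hAi : ∀ l, Integrable (A l) P := fun l =>
    Integrable.of_bound ((hAm l).mono (h.history_le _) le_rfl).aestronglyMeasurable 1
      (Eventually.of_forall fun ω => by
        rw [Real.norm_of_nonneg (hA01 l ω).1]; exact (hA01 l ω).2)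
  have hce : ∀ l, ∀ᵐ ω ∂P, 0 ≤ (P[A l | history I Y l]) ω ∧ (P[A l | history I Y l]) ω ≤ 1 := by
    intro l
    have h1 : 0 ≤ᵐ[P] P[A l | history I Y l] :=
      condExp_nonneg (Eventually.of_forall fun ω => (hA01 l ω).1)
    have h2 : P[A l | history I Y l] ≤ᵐ[P] P[fun _ => (1 : ℝ) | history I Y l] :=
      condExp_mono (hAi l) (integrable_const _) (Eventually.of_forall fun ω => (hA01 l ω).2)
    rw [condExp_const (h.history_le l)] at h2
    filter_upwards [h1, h2] with ω h1 h2
    exact ⟨h1, h2⟩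
  have hDbd : ∀ l, ∀ᵐ ω ∂P, ‖D l ω‖ ≤ 1 / ((l : ℝ) + 1) := by
    intro l
    filter_upwards [hce l] with ω hω
    simp only [hD, Pi.smul_apply, Pi.sub_apply, norm_smul]
    rw [Real.norm_of_nonneg (by positivity)]
    refine mul_le_of_le_one_right (by positivity) ?_
    rw [Real.norm_eq_abs, abs_le]
    constructor <;> linarith [(hA01 l ω).1, (hA01 l ω).2, hω.1, hω.2]
  have hDm : ∀ l, StronglyMeasurable[history I Y (l + 1)] (D l) := fun l =>
    ((hAm l).stronglyMeasurable.sub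
      (stronglyMeasurable_condExp.mono (history_mono (Nat.le_succ l)))).const_smul _
  have hDm' : ∀ l, AEStronglyMeasurable (D l) P := fun l =>
    ((hDm l).mono (h.history_le _)).aestronglyMeasurable
  have hconv := ae_exists_tendsto_sum_of_sq_bdd h.filtration D hDm
    (fun l => MemLp.of_bound (hDm' l) _ (hDbd l)) (fun l => by
      change P[D l | history I Y l] =ᵐ[P] 0
      refine (condExp_smul _ _ _).trans ?_
      have h1 := condExp_sub (hAi l) (integrable_condExp (μ := P) (m := history I Y l) (f := A l))
        (history I Y l)
      have h2 := condExp_condExp_of_le (f := A l) (μ := P) (le_refl (history I Y l))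
        (h.history_le l)
      filter_upwards [h1, h2] with ω h1 h2
      simp only [Pi.smul_apply, h1, Pi.sub_apply, h2]
      simp) 2 (fun n => by
      have h1 : ∀ l : ℕ, ∫ ω, D l ω ^ 2 ∂P ≤ (1 / ((l : ℝ) + 1)) ^ 2 := by
        intro l
        calc ∫ ω, D l ω ^ 2 ∂P ≤ ∫ _, (1 / ((l : ℝ) + 1)) ^ 2 ∂P := by
              refine integral_mono_ae (MemLp.of_bound (hDm' l) _ (hDbd l)).integrable_sq
                (integrable_const _) ?_
              filter_upwards [hDbd l] with ω hω
              rw [← sq_abs, ← Real.norm_eq_abs]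
              gcongr
          _ = _ := by simp
      refine (Finset.sum_le_sum fun l _ => h1 l).trans ?_
      have h2 : ∀ N : ℕ, ∑ l ∈ Finset.range N, (1 / ((l : ℝ) + 1)) ^ 2 ≤ 2 - 2 / ((N : ℝ) + 1) := by
        intro N
        induction N with
        | zero => simp
        | succ N ih =>
          rw [Finset.sum_range_succ]
          have : (1 / ((N : ℝ) + 1)) ^ 2 ≤ 2 / ((N : ℝ) + 1) - 2 / ((N : ℝ) + 1 + 1) := by
            have hN : (0 : ℝ) ≤ N := Nat.cast_nonneg N
            rw [div_sub_div _ _ (by positivity) (by positivity), div_pow,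
              div_le_div_iff₀ (by positivity) (by positivity)]
            nlinarith
          push_cast
          linarith
      refine (h2 n).trans ?_
      have : 0 ≤ 2 / ((n : ℝ) + 1) := by positivity
      linarith)
  have hstep : ∀ᵐ ω ∂P, ∀ l, K < l →
      (P[A l | history I Y l]) ω = stepProb β (posteriorAt σ I Y l ω) i := by
    rw [ae_all_iff]
    intro l
    by_cases hl : K < l
    · have hl1 : 1 ≤ l := by omega
      have hAl : A l = (I l ⁻¹' {i}).indicator (fun _ => (1 : ℝ)) := by simp [hA, hl1]
      rw [hAl]
      filter_upwards [h.step l hl i] with ω hω _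
      exact hω
    · exact Eventually.of_forall fun ω hl' => absurd hl' hl
  filter_upwards [hconv, hstep] with ω ⟨s, hs⟩ hω
  refine ⟨fun l => (P[A l | history I Y l]) ω, hω, ?_⟩
  have hk := tendsto_sum_mul_sub_div (b := fun n : ℕ => (n : ℝ)) Nat.mono_cast
    tendsto_natCast_atTop_atTop hs
  refine hk.congr fun n => ?_
  congr 1
  have e1 : ∀ l : ℕ, ((l + 1 : ℕ) : ℝ) * D l ω = A l ω - (P[A l | history I Y l]) ω := by
    intro l
    simp only [hD, Pi.smul_apply, Pi.sub_apply, smul_eq_mul]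
    push_cast
    have : (l : ℝ) + 1 ≠ 0 := by positivity
    field_simp
  simp only [Finset.sum_range_succ_sub_sum, e1, Finset.sum_sub_distrib]
  congr 1
  induction n with
  | zero => simp [pulls_zero]
  | succ n ih =>
    rw [Finset.sum_range_succ, ih]
    rcases Nat.eq_zero_or_pos n with rfl | (hn : 1 ≤ n)
    · simp [pulls_zero, pulls_one, hA]
    · rw [pulls_succ I hn]
      by_cases hi : I n ω = i
      · simp only [hA, if_pos hn]
        simp [hi]
      · simp only [hA, if_pos hn]
        simp [hi]

end IsTTTS

/-! ### Posterior tails in terms of transportation costs -/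

section Exponents

variable {K : ℕ} {σ : ℝ} {m : Fin K → ℝ} {T : Fin K → ℕ}

/-- The exponent of the posterior probability that arm `j` is better than arm `k`. -/
noncomputable def exponent (σ : ℝ) (m : Fin K → ℝ) (T : Fin K → ℕ) (k j : Fin K) : ℝ :=
  kl σ (m k) (m j) * halfHarm (T k) (T j)

lemma kl_nonneg (σ x y : ℝ) : 0 ≤ kl σ x y := by unfold kl; positivity

lemma exponent_nonneg (σ : ℝ) (m : Fin K → ℝ) (T : Fin K → ℕ) (k j : Fin K) :
    0 ≤ exponent σ m T k j :=
  mul_nonneg (kl_nonneg _ _ _) (halfHarm_nonneg (Nat.cast_nonneg _) (Nat.cast_nonneg _))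

lemma halfHarm_eq_inv {a b : ℝ} (ha : 0 < a) (hb : 0 < b) :
    halfHarm a b = (a⁻¹ + b⁻¹)⁻¹ := by
  unfold halfHarm; field_simp; ring

lemma halfHarm_eq_mul {n : ℝ} (hn : 0 < n) (a b : ℝ) :
    halfHarm a b = n * halfHarm (a / n) (b / n) := by
  unfold halfHarm
  rw [← add_div, div_mul_div_comm]
  rcases eq_or_ne (a + b) 0 with h | h
  · simp [h]
  · field_simp

lemma exponent_eq_mul {n : ℕ} (hn : 0 < n) (σ : ℝ) (m : Fin K → ℝ) (T : Fin K → ℕ)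
    (k j : Fin K) :
    exponent σ m T k j =
      n * (kl σ (m k) (m j) * halfHarm ((T k : ℝ) / n) ((T j : ℝ) / n)) := by
  rw [exponent, halfHarm_eq_mul (n := (n : ℝ)) (by exact_mod_cast hn)]
  ring

/-- The link between posterior and optimization: the variance of a difference is σ² times the
inverse of `halfHarm` of the counts, so the Gaussian exponent has the form of the cost in `cost_eq`.
-/
lemma sq_div_diffVar (hσ : 0 < σ) {j k : Fin K} (hj : 1 ≤ T j) (hk : 1 ≤ T k) :
    (m k - m j) ^ 2 / (2 * diffVar σ T j k) = exponent σ m T k j := by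
  have h1 : (0 : ℝ) < T j := by exact_mod_cast hj
  have h2 : (0 : ℝ) < T k := by exact_mod_cast hk
  rw [coe_diffVar, exponent, halfHarm, kl]
  field_simp

/-- A Gaussian lower tail bound as a function of the exponent. -/
noncomputable def tailBound (x : ℝ) : ℝ :=
  (√(2 * Real.pi))⁻¹ * Real.exp (-(x + √(2 * x) + 1 / 2))

lemma tailBound_pos (x : ℝ) : 0 < tailBound x := by unfold tailBound; positivity

lemma tailBound_anti {x y : ℝ} (hxy : x ≤ y) : tailBound y ≤ tailBound x := by
  unfold tailBound
  gcongr

lemma real_le_exp_neg_exponent (hσ : 0 < σ) {j k : Fin K} (hjk : j ≠ k) (hT : ∀ i, 1 ≤ T i)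
    (h : m j ≤ m k) :
    (posterior σ m T).real {θ | θ k ≤ θ j} ≤ Real.exp (-exponent σ m T k j) := by
  rw [← sq_div_diffVar hσ (hT j) (hT k)]
  exact posterior_real_le m T hσ hjk (hT j) h

lemma one_sub_optimalProb_le (hσ : 0 < σ) {k : Fin K} (hT : ∀ i, 1 ≤ T i)
    (h : ∀ j, m j ≤ m k) :
    1 - optimalProb (posterior σ m T) k ≤
      ∑ j ∈ Finset.univ.erase k, Real.exp (-exponent σ m T k j) :=
  (one_sub_optimalProb_le_sum _ k).trans (Finset.sum_le_sum fun j hj =>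
    real_le_exp_neg_exponent hσ (Finset.ne_of_mem_erase hj) hT (h j))

variable [NeZero K]

lemma armProb_le_exp_neg_exponent (hσ : 0 < σ) {j k : Fin K} (hjk : j ≠ k)
    (hT : ∀ i, 1 ≤ T i) (h : m j ≤ m k) :
    armProb (posterior σ m T) j ≤ Real.exp (-exponent σ m T k j) :=
  (armProb_le_real _).trans (real_le_exp_neg_exponent hσ hjk hT h)

/-- For exponent x the standardised gap is √(2x), and (√(2x) + 1)² / 2 = x + √(2x) + 1/2; the
correction to x is of lower order. -/
lemma tailBound_le_one_sub_armProb (hσ : 0 < σ) {j k : Fin K} (hjk : j ≠ k)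
    (hT : ∀ i, 1 ≤ T i) (h : m j ≤ m k) :
    tailBound (exponent σ m T k j) ≤ 1 - armProb (posterior σ m T) k := by
  refine le_trans (le_of_eq ?_)
    ((le_posterior_real m T hσ hjk (hT j) h).trans (real_lt_le_one_sub_armProb _ k j))
  have hv : 0 < (diffVar σ T j k : ℝ) :=
    NNReal.coe_pos.2 (pos_iff_ne_zero.2 (diffVar_ne_zero T hσ (hT j)))
  have h1 : (m k - m j) / √(diffVar σ T j k) = √(2 * exponent σ m T k j) := by
    rw [← sq_div_diffVar hσ (hT j) (hT k)]
    have : 2 * ((m k - m j) ^ 2 / (2 * diffVar σ T j k)) = (m k - m j) ^ 2 / diffVar σ T j k := by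
      field_simp
    rw [this, Real.sqrt_div (sq_nonneg _), Real.sqrt_sq (by linarith)]
  have h2 : √(2 * exponent σ m T k j) ^ 2 = 2 * exponent σ m T k j :=
    Real.sq_sqrt (mul_nonneg (by norm_num) (exponent_nonneg _ _ _ _ _))
  rw [h1, tailBound]
  congr 2
  linear_combination (1 / 2 : ℝ) * h2

end Exponents

/-! ### Counting processes driven by their conditional probabilities -/

section Averages

/-- If a counting process has increments that are small on average whenever it exceeds the line
of slope `v`, it does not exceed lines of larger slope in the long run. -/
lemma eventually_le_of_small_above {T : ℕ → ℕ} {φ : ℕ → ℝ} {v : ℝ} (hv : 0 ≤ v)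
    (hbal : Tendsto (fun n : ℕ => ((T n : ℝ) - ∑ l ∈ Finset.range n, φ l) / n) atTop (𝓝 0))
    (hφ : ∀ᶠ n in atTop, φ n ≤ 1)
    (hsmall : ∀ η > 0, ∀ᶠ n : ℕ in atTop, v * n ≤ T n → φ n ≤ η) {ε : ℝ} (hε : 0 < ε) :
    ∀ᶠ n : ℕ in atTop, (T n : ℝ) / n ≤ v + ε := by
  -- The balance errors at `n` and `p`, the drift between them and the constant `T N + 1` cost at
  -- most η n each.
  set η : ℝ := ε / 4 with hη
  have hηpos : 0 < η := by positivity
  have hE : ∀ᶠ n : ℕ in atTop, |(T n : ℝ) - ∑ l ∈ Finset.range n, φ l| ≤ η * n := by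
    have h1 := (tendsto_order.1 hbal.abs).2 η (by simpa using hηpos)
    filter_upwards [h1, eventually_gt_atTop 0] with n hn hn0
    have hn0' : (0 : ℝ) < n := by exact_mod_cast hn0
    rw [abs_div, abs_of_pos hn0', div_lt_iff₀ hn0'] at hn
    exact hn.le
  obtain ⟨N, hN⟩ := eventually_atTop.1 (hE.and (hφ.and (hsmall η hηpos)))
  -- `p` is the last time before `n` at which `T` was below the line, or `N` if there is none, which
  -- the term `T N` absorbs. Since then each increment is at most η, except the one at `p`, which is
  -- at most 1.
  have claim : ∀ n, N ≤ n → ∃ p, N ≤ p ∧ p ≤ n ∧ (T p : ℝ) ≤ v * p + T N ∧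
      ∑ l ∈ Finset.range n, φ l - ∑ l ∈ Finset.range p, φ l ≤ 1 + η * (n - p) := by
    intro n hn
    induction n, hn using Nat.le_induction with
    | base => exact ⟨N, le_rfl, le_rfl, by linarith [mul_nonneg hv (Nat.cast_nonneg (α := ℝ) N)],
        by simp⟩
    | succ n hn ih =>
      by_cases hc : v * n ≤ T n
      · obtain ⟨p, hp1, hp2, hp3, hp4⟩ := ih
        refine ⟨p, hp1, hp2.trans (Nat.le_succ n), hp3, ?_⟩
        rw [Finset.sum_range_succ]
        have := (hN n hn).2.2 hc
        push_cast
        linarith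
      · refine ⟨n, hn, Nat.le_succ n, ?_, ?_⟩
        · push Not at hc
          linarith [Nat.cast_nonneg (α := ℝ) (T N)]
        · rw [Finset.sum_range_succ]
          have := (hN n hn).2.1
          push_cast
          linarith
  filter_upwards [eventually_ge_atTop N, eventually_gt_atTop 0,
    tendsto_natCast_atTop_atTop.eventually_ge_atTop (((T N : ℝ) + 1) / η)] with n hn hn0 hnC
  have hn0' : (0 : ℝ) < n := by exact_mod_cast hn0
  obtain ⟨p, hp1, hp2, hp3, hp4⟩ := claim n hn
  have e1 := abs_le.1 (hN n hn).1
  have e2 := abs_le.1 (hN p hp1).1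
  have hpn : (p : ℝ) ≤ n := by exact_mod_cast hp2
  rw [div_le_iff₀ hηpos] at hnC
  rw [div_le_iff₀ hn0']
  have h1 : v * p ≤ v * n := mul_le_mul_of_nonneg_left hpn hv
  have h3 : (v + ε) * n = v * n + 4 * (η * n) := by rw [hη]; ring
  rw [h3]
  nlinarith [e1.2, e2.1]

lemma tendsto_div_of_balance {T : ℕ → ℕ} {φ : ℕ → ℝ} {v : ℝ}
    (hbal : Tendsto (fun n : ℕ => ((T n : ℝ) - ∑ l ∈ Finset.range n, φ l) / n) atTop (𝓝 0))
    (hφ : Tendsto φ atTop (𝓝 v)) :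
    Tendsto (fun n : ℕ => (T n : ℝ) / n) atTop (𝓝 v) := by
  have := hbal.add hφ.cesaro
  rw [zero_add] at this
  refine this.congr fun n => ?_
  rw [sub_div, div_eq_inv_mul (∑ l ∈ Finset.range n, φ l)]
  ring

lemma unbounded_of_balance {T : ℕ → ℕ} {φ : ℕ → ℝ} {c : ℝ} (hc : 0 < c) (L : ℕ)
    (hbal : Tendsto (fun n : ℕ => ((T n : ℝ) - ∑ l ∈ Finset.range n, φ l) / n) atTop (𝓝 0))
    (hφ : ∀ᶠ n in atTop, c ≤ φ n) : ¬ ∀ n, T n ≤ L := by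
  intro hL
  -- Truncation at `c` produces a convergent sequence, so that Cesàro's theorem applies although `φ`
  -- need not converge.
  have h1 : Tendsto (fun n => min (φ n) c) atTop (𝓝 c) := by
    refine tendsto_const_nhds.congr' ?_
    filter_upwards [hφ] with n hn
    rw [min_eq_right hn]
  have h2 : Tendsto (fun n : ℕ => (L : ℝ) / n) atTop (𝓝 0) :=
    tendsto_const_div_atTop_nhds_zero_nat _
  have h3 := h2.sub h1.cesaro
  have h4 : (0 : ℝ) ≤ 0 - c := by
    refine le_of_tendsto_of_tendsto' hbal h3 fun n => ?_
    rw [sub_div, div_eq_inv_mul (∑ l ∈ Finset.range n, φ l)]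
    refine sub_le_sub ?_ ?_
    · gcongr
      exact_mod_cast hL n
    · gcongr
      exact min_le_left _ _
  linarith

end Averages

/-! ### Deterministic analysis of a path: exploration and the best arm -/

/-- The properties of the numbers of plays `T` and the empirical means `m` that hold almost surely
along the paths of top-two Thompson sampling. -/
structure RegularPath {K : ℕ} [NeZero K] (σ : ℝ) (μ : Fin K → ℝ) (β : ℝ) (T : ℕ → Fin K → ℕ)
    (m : ℕ → Fin K → ℝ) : Prop where
  one_le : ∀ n, K < n → ∀ i, 1 ≤ T n i
  mono : ∀ i, Monotone fun n => T n i
  sum_eq : ∀ n, ∑ i, T n i = n - 1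
  mean_succ : ∀ n, 1 ≤ n → ∀ i, T (n + 1) i = T n i → m (n + 1) i = m n i
  consistent : ∀ i, Tendsto (fun n => T n i) atTop atTop → Tendsto (fun n => m n i) atTop (𝓝 (μ i))
  balance : ∀ i, ∃ φ : ℕ → ℝ,
    (∀ l, K < l → φ l = stepProb β (posterior σ (m l) (T l)) i) ∧
    Tendsto (fun n : ℕ => ((T n i : ℝ) - ∑ l ∈ Finset.range n, φ l) / n) atTop (𝓝 0)

namespace RegularPath

variable {K : ℕ} [NeZero K] {σ : ℝ} {μ : Fin K → ℝ} {β : ℝ} {T : ℕ → Fin K → ℕ}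
  {m : ℕ → Fin K → ℝ}

/-- The mean of an arm that is played finitely often is eventually frozen. This gives bounded means
before it is known that all arms are played infinitely often. -/
lemma exists_tendsto_mean (h : RegularPath σ μ β T m) (i : Fin K) :
    ∃ x, Tendsto (fun n => m n i) atTop (𝓝 x) := by
  rcases tendsto_atTop_of_monotone (h.mono i) with ht | ⟨L, hL⟩
  · exact ⟨_, h.consistent i ht⟩
  · rw [nhds_discrete, tendsto_pure] at hL
    obtain ⟨N, hN⟩ := eventually_atTop.1 hL
    refine ⟨m (N + 1) i, tendsto_const_nhds.congr' ?_⟩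
    filter_upwards [eventually_ge_atTop (N + 1)] with n hn
    induction n, hn using Nat.le_induction with
    | base => rfl
    | succ n hn ih =>
      rw [h.mean_succ n (by omega) i (by rw [hN _ (by omega), hN _ (by omega)])]
      exact ih

lemma exists_abs_mean_le (h : RegularPath σ μ β T m) : ∃ B, ∀ n i, |m n i| ≤ B := by
  have : ∀ i, ∃ B, ∀ n, |m n i| ≤ B := fun i => by
    obtain ⟨x, hx⟩ := h.exists_tendsto_mean i
    obtain ⟨B, hB⟩ := hx.abs.bddAbove_range
    exact ⟨B, fun n => hB ⟨n, rfl⟩⟩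
  choose B hB using this
  refine ⟨∑ i, |B i|, fun n i => (hB i n).trans ((le_abs_self _).trans ?_)⟩
  exact Finset.single_le_sum (f := fun i => |B i|) (fun i _ => abs_nonneg _) (Finset.mem_univ i)

/-- Every arm is played infinitely often. -/
lemma tendsto_pulls (h : RegularPath σ μ β T m) (hσ : 0 < σ) (hβ₀ : 0 < β) (hβ₁ : β < 1)
    (i : Fin K) : Tendsto (fun n => T n i) atTop atTop := by
  rcases tendsto_atTop_of_monotone (h.mono i) with ht | ⟨L, hL⟩
  · exact ht
  · exfalso
    have hle : ∀ n, T n i ≤ L := fun n => (h.mono i).ge_of_tendsto hL n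
    obtain ⟨B, hB⟩ := h.exists_abs_mean_le
    obtain ⟨c, hc, hcle⟩ := exists_le_optimalProb (K := K) hσ B L
    obtain ⟨φ, hφ, hbal⟩ := h.balance i
    refine unbounded_of_balance (mul_pos hβ₀ hc) L hbal ?_ hle
    filter_upwards [eventually_gt_atTop K] with n hn
    rw [hφ n hn]
    refine le_trans ?_ (mul_armProb_le_stepProb _ hβ₁ i)
    refine mul_le_mul_of_nonneg_left ?_ hβ₀.le
    exact (hcle (m n) (T n) i (hB n) (h.one_le n hn) (hle n)).trans (optimalProb_le_armProb _ i)

lemma tendsto_mean (h : RegularPath σ μ β T m) (hσ : 0 < σ) (hβ₀ : 0 < β) (hβ₁ : β < 1)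
    (i : Fin K) : Tendsto (fun n => m n i) atTop (𝓝 (μ i)) :=
  h.consistent i (h.tendsto_pulls hσ hβ₀ hβ₁ i)

lemma tendsto_kl (h : RegularPath σ μ β T m) (hσ : 0 < σ) (hβ₀ : 0 < β) (hβ₁ : β < 1)
    (k j : Fin K) : Tendsto (fun n => kl σ (m n k) (m n j)) atTop (𝓝 (kl σ (μ k) (μ j))) := by
  unfold kl
  exact ((((h.tendsto_mean hσ hβ₀ hβ₁ k).sub (h.tendsto_mean hσ hβ₀ hβ₁ j)).pow 2).div_const _)

lemma eventually_mean_le (h : RegularPath σ μ β T m) (hσ : 0 < σ) (hβ₀ : 0 < β) (hβ₁ : β < 1)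
    {istar : Fin K} (histar : ∀ i, i ≠ istar → μ i < μ istar) :
    ∀ᶠ n in atTop, ∀ i, m n i ≤ m n istar := by
  rw [eventually_all]
  intro i
  by_cases hi : i = istar
  · simp [hi]
  · exact ((h.tendsto_mean hσ hβ₀ hβ₁ i).eventually_lt (h.tendsto_mean hσ hβ₀ hβ₁ istar)
      (histar i hi)).mono fun n hn => hn.le

lemma tendsto_exponent_atTop (h : RegularPath σ μ β T m) (hσ : 0 < σ) (hβ₀ : 0 < β) (hβ₁ : β < 1)
    {istar : Fin K} (histar : ∀ i, i ≠ istar → μ i < μ istar) {j : Fin K} (hj : j ≠ istar) :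
    Tendsto (fun n => exponent σ (m n) (T n) istar j) atTop atTop := by
  refine (h.tendsto_kl hσ hβ₀ hβ₁ istar j).pos_mul_atTop (kl_pos hσ (histar j hj)) ?_
  have hT : ∀ i, Tendsto (fun n => (T n i : ℝ)) atTop atTop := fun i =>
    tendsto_natCast_atTop_atTop.comp (h.tendsto_pulls hσ hβ₀ hβ₁ i)
  have h1 : Tendsto (fun n => ((T n istar : ℝ))⁻¹ + ((T n j : ℝ))⁻¹) atTop (𝓝[>] 0) := by
    refine tendsto_nhdsWithin_iff.2 ⟨?_, ?_⟩
    · simpa using (tendsto_inv_atTop_zero.comp (hT istar)).add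
        (tendsto_inv_atTop_zero.comp (hT j))
    · filter_upwards [(hT istar).eventually_gt_atTop 0, (hT j).eventually_gt_atTop 0]
        with n h1 h2
      exact add_pos (inv_pos.2 h1) (inv_pos.2 h2)
  refine (tendsto_inv_nhdsGT_zero.comp h1).congr' ?_
  filter_upwards [(hT istar).eventually_gt_atTop 0, (hT j).eventually_gt_atTop 0] with n h1 h2
  exact (halfHarm_eq_inv h1 h2).symm

lemma tendsto_one_sub_armProb (h : RegularPath σ μ β T m) (hσ : 0 < σ) (hβ₀ : 0 < β)
    (hβ₁ : β < 1) {istar : Fin K} (histar : ∀ i, i ≠ istar → μ i < μ istar) :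
    Tendsto (fun n => 1 - armProb (posterior σ (m n) (T n)) istar) atTop (𝓝 0) := by
  have h1 : Tendsto (fun n => ∑ j ∈ Finset.univ.erase istar,
      Real.exp (-exponent σ (m n) (T n) istar j)) atTop (𝓝 0) := by
    rw [← Finset.sum_const_zero (s := Finset.univ.erase istar)]
    refine tendsto_finsetSum _ fun j hj => ?_
    exact Real.tendsto_exp_neg_atTop_nhds_zero.comp
      (h.tendsto_exponent_atTop hσ hβ₀ hβ₁ histar (Finset.ne_of_mem_erase hj))
  refine squeeze_zero' (Eventually.of_forall fun n => sub_nonneg.2 measureReal_le_one) ?_ h1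
  filter_upwards [eventually_gt_atTop K, h.eventually_mean_le hσ hβ₀ hβ₁ histar] with n hn hm
  exact (one_sub_armProb_le_one_sub_optimalProb _ _).trans
    (one_sub_optimalProb_le hσ (h.one_le n hn) hm)

lemma eventually_armProb_lt_one (h : RegularPath σ μ β T m) (hK : 2 ≤ K) (hσ : 0 < σ)
    (hβ₀ : 0 < β) (hβ₁ : β < 1) {istar : Fin K} (histar : ∀ i, i ≠ istar → μ i < μ istar) :
    ∀ᶠ n in atTop, armProb (posterior σ (m n) (T n)) istar < 1 := by
  have : Nontrivial (Fin K) := Fin.nontrivial_iff_two_le.2 hK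
  obtain ⟨j, hj⟩ := exists_ne istar
  filter_upwards [eventually_gt_atTop K, h.eventually_mean_le hσ hβ₀ hβ₁ histar] with n hn hm
  have := (tailBound_pos _).trans_le
    (tailBound_le_one_sub_armProb hσ hj (h.one_le n hn) (hm j))
  linarith

/-- The play probability of `istar` lies between β α and β + (1 - α), where α is its `armProb`, and
α tends to 1. -/
lemma tendsto_pulls_div_best (h : RegularPath σ μ β T m) (hK : 2 ≤ K) (hσ : 0 < σ)
    (hβ₀ : 0 < β) (hβ₁ : β < 1) {istar : Fin K} (histar : ∀ i, i ≠ istar → μ i < μ istar) :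
    Tendsto (fun n : ℕ => (T n istar : ℝ) / n) atTop (𝓝 β) := by
  obtain ⟨φ, hφ, hbal⟩ := h.balance istar
  refine tendsto_div_of_balance hbal ?_
  have h1 := h.tendsto_one_sub_armProb hσ hβ₀ hβ₁ histar
  have hlo : Tendsto (fun n => β * (1 - (1 - armProb (posterior σ (m n) (T n)) istar)))
      atTop (𝓝 β) := by
    simpa using (h1.const_sub 1).const_mul β
  have hup : Tendsto (fun n => β + (1 - armProb (posterior σ (m n) (T n)) istar))
      atTop (𝓝 β) := by
    simpa using h1.const_add β
  refine tendsto_of_tendsto_of_tendsto_of_le_of_le' hlo hup ?_ ?_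
  · filter_upwards [eventually_gt_atTop K] with n hn
    rw [hφ n hn, sub_sub_cancel]
    exact mul_armProb_le_stepProb _ hβ₁ istar
  · filter_upwards [eventually_gt_atTop K, h.eventually_armProb_lt_one hK hσ hβ₀ hβ₁ histar]
      with n hn hlt
    rw [hφ n hn]
    exact stepProb_le_self _ hβ₀ hlt

end RegularPath

/-! ### Comparison of exponential rates -/

lemma tendsto_sqrt_mul_div_nhds_zero (a : ℝ) :
    Tendsto (fun n : ℕ => √(2 * (n * a)) / n) atTop (𝓝 0) := by
  have h1 : Tendsto (fun n : ℕ => √(2 * a) * (√(n : ℝ))⁻¹) atTop (𝓝 (√(2 * a) * 0)) :=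
    (tendsto_inv_atTop_zero.comp
      (Real.tendsto_sqrt_atTop.comp tendsto_natCast_atTop_atTop)).const_mul _
  rw [mul_zero] at h1
  refine h1.congr fun n => ?_
  have hn : (0 : ℝ) ≤ n := Nat.cast_nonneg n
  rw [show 2 * ((n : ℝ) * a) = n * (2 * a) by ring, Real.sqrt_mul hn, ← Real.sqrt_div_self]
  ring

lemma tendsto_log_tailBound (a : ℝ) :
    Tendsto (fun n : ℕ => -(1 / (n : ℝ)) * Real.log (tailBound (n * a))) atTop (𝓝 a) := by
  set c := Real.log (√(2 * Real.pi))⁻¹ with hc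
  have h1 : Tendsto (fun n : ℕ => a + √(2 * (n * a)) / n + (1 / 2 - c) / (n : ℝ)) atTop
      (𝓝 (a + 0 + 0)) :=
    ((tendsto_sqrt_mul_div_nhds_zero a).const_add a).add
      (tendsto_const_div_atTop_nhds_zero_nat _)
  rw [add_zero, add_zero] at h1
  refine h1.congr' ?_
  filter_upwards [eventually_gt_atTop 0] with n hn
  have hn' : (n : ℝ) ≠ 0 := by exact_mod_cast hn.ne'
  rw [tailBound, Real.log_mul (by positivity) (Real.exp_pos _).ne', Real.log_exp, ← hc]
  field_simp
  ring

/-- The logarithm of the ratio is n times a sequence tending to a - b < 0. -/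
lemma tendsto_exp_div_tailBound {a b : ℝ} (hab : a < b) :
    Tendsto (fun n : ℕ => Real.exp (-(n * b)) / tailBound (n * a)) atTop (𝓝 0) := by
  have h1 : Tendsto (fun n : ℕ =>
      (n : ℝ) * (-(1 / (n : ℝ)) * Real.log (tailBound (n * a)) - b)) atTop atBot :=
    tendsto_natCast_atTop_atTop.atTop_mul_neg (sub_neg.2 hab)
      ((tendsto_log_tailBound a).sub_const b)
  refine (Real.tendsto_exp_atBot.comp h1).congr' ?_
  filter_upwards [eventually_gt_atTop 0] with n hn
  have hn' : (n : ℝ) ≠ 0 := by exact_mod_cast hn.ne'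
  have : (n : ℝ) * (-(1 / (n : ℝ)) * Real.log (tailBound (n * a)) - b) =
      -(n * b) - Real.log (tailBound (n * a)) := by
    field_simp
    ring
  rw [Function.comp_apply, this, Real.exp_sub, Real.exp_log (tailBound_pos _)]

/-! ### Convergence of the proportions and of the posterior rate -/

namespace RegularPath

variable {K : ℕ} [NeZero K] {σ : ℝ} {μ : Fin K → ℝ} {β : ℝ} {T : ℕ → Fin K → ℕ}
  {m : ℕ → Fin K → ℝ}

lemma tendsto_sum_pulls_div (h : RegularPath σ μ β T m) :
    Tendsto (fun n : ℕ => ∑ i, (T n i : ℝ) / n) atTop (𝓝 1) := by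
  have h1 : Tendsto (fun n : ℕ => (1 : ℝ) - 1 / n) atTop (𝓝 (1 - 0)) :=
    (tendsto_const_div_atTop_nhds_zero_nat 1).const_sub 1
  rw [sub_zero] at h1
  refine h1.congr' ?_
  filter_upwards [eventually_gt_atTop 0] with n hn
  have hn' : (n : ℝ) ≠ 0 := by exact_mod_cast hn.ne'
  rw [← Finset.sum_div, ← Nat.cast_sum, h.sum_eq, Nat.cast_sub (by omega)]
  push_cast
  field_simp

/-- An arm that is played more often than in the equalising allocation `w` is played with a
vanishing probability. -/
lemma eventually_stepProb_le (h : RegularPath σ μ β T m) (hK : 2 ≤ K) (hσ : 0 < σ)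
    (hβ₀ : 0 < β) (hβ₁ : β < 1) {istar : Fin K} (histar : ∀ i, i ≠ istar → μ i < μ istar)
    {w : Fin K → ℝ} {r : ℝ} (hwstar : w istar = β) (hwsum : ∑ i, w i = 1)
    (hw : ∀ i, i ≠ istar → 0 < w i ∧ kl σ (μ istar) (μ i) * halfHarm β (w i) = r)
    {i : Fin K} (hi : i ≠ istar) {δ : ℝ} (hδ : 0 < δ) {η : ℝ} (hη : 0 < η) :
    ∀ᶠ n : ℕ in atTop, (w i + δ) * n ≤ T n i →
      stepProb β (posterior σ (m n) (T n)) i ≤ η := by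
  have hbest := h.tendsto_pulls_div_best hK hσ hβ₀ hβ₁ histar
  have hgap : r < kl σ (μ istar) (μ i) * halfHarm β (w i + δ) := by
    rw [← (hw i hi).2]
    exact mul_lt_mul_of_pos_left (halfHarm_lt_right hβ₀ (hw i hi).1.le (by linarith))
      (kl_pos hσ (histar i hi))
  -- `a` will bound the cost rate of an undersampled arm from above, and `b > a` that of the
  -- oversampled arm `i` from below.
  obtain ⟨a, ha₁, ha₂⟩ := exists_between hgap
  obtain ⟨b, hb₁, hb₂⟩ := exists_between ha₂
  have hup : ∀ᶠ n : ℕ in atTop,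
      b < kl σ (m n istar) (m n i) * halfHarm ((T n istar : ℝ) / n) (w i + δ) :=
    ((h.tendsto_kl hσ hβ₀ hβ₁ istar i).mul (tendsto_halfHarm hβ₀ (by linarith [(hw i hi).1])
      hbest tendsto_const_nhds)).eventually_const_lt hb₂
  have hlo : ∀ᶠ n : ℕ in atTop, ∀ j, j ≠ istar →
      kl σ (m n istar) (m n j) * halfHarm ((T n istar : ℝ) / n) (w j) < a := by
    rw [eventually_all]
    intro j
    by_cases hj : j = istar
    · simp [hj]
    · have := ((h.tendsto_kl hσ hβ₀ hβ₁ istar j).mul (tendsto_halfHarm hβ₀ (hw j hj).1.le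
        hbest tendsto_const_nhds)).eventually_lt_const ((hw j hj).2.trans_lt ha₁)
      exact this.mono fun n hn _ => hn
  -- The excesses over `w` of the suboptimal arms have total tending to 0, so an excess of δ at `i`
  -- forces a deficit at some `j`.
  have hothers : ∀ᶠ n : ℕ in atTop,
      ∑ j ∈ Finset.univ.erase istar, ((T n j : ℝ) / n - w j) < δ := by
    have h1 := h.tendsto_sum_pulls_div.sub hbest
    refine ((h1.sub_const (1 - β)).congr fun n => ?_).eventually_lt_const (u := δ)
      (v := 1 - β - (1 - β)) (by linarith)
    rw [Finset.sum_sub_distrib, ← Finset.add_sum_erase _ (fun j => (T n j : ℝ) / n)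
      (Finset.mem_univ istar)]
    rw [← Finset.add_sum_erase _ w (Finset.mem_univ istar), hwstar] at hwsum
    linarith
  have hratio := (tendsto_exp_div_tailBound hb₁).eventually_lt_const
    (show (0 : ℝ) < η / 3 by positivity)
  have hone := (h.tendsto_one_sub_armProb hσ hβ₀ hβ₁ histar).eventually_lt_const
    (show (0 : ℝ) < η / 3 by positivity)
  filter_upwards [hup, hlo, hothers, hratio, hone, eventually_gt_atTop K,
    h.eventually_mean_le hσ hβ₀ hβ₁ histar, h.eventually_armProb_lt_one hK hσ hβ₀ hβ₁ histar]
    with n hup hlo hothers hratio hone hn hm hlt hTi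
  have hn0 : 0 < n := by omega
  have hn0' : (0 : ℝ) < n := by exact_mod_cast hn0
  have hTpos : ∀ j, 0 < (T n j : ℝ) / n := fun j => by
    have : (0 : ℝ) < T n j := by exact_mod_cast h.one_le n hn j
    positivity
  have hTi' : w i + δ ≤ (T n i : ℝ) / n := (le_div_iff₀ hn0').2 hTi
  obtain ⟨j, hj, hTj⟩ : ∃ j, j ≠ istar ∧ (T n j : ℝ) / n < w j := by
    by_contra! hcon
    have := Finset.single_le_sum (f := fun j => (T n j : ℝ) / n - w j)
      (s := Finset.univ.erase istar)
      (fun j hj => sub_nonneg.2 (hcon j (Finset.ne_of_mem_erase hj)))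
      (Finset.mem_erase.2 ⟨hi, Finset.mem_univ i⟩)
    linarith
  set Q := posterior σ (m n) (T n)
  have hα : armProb Q i ≤ Real.exp (-(n * b)) := by
    refine (armProb_le_exp_neg_exponent hσ hi (h.one_le n hn) (hm i)).trans
      (Real.exp_le_exp.2 (neg_le_neg ?_))
    rw [exponent_eq_mul hn0]
    refine mul_le_mul_of_nonneg_left (hup.le.trans ?_) hn0'.le
    exact mul_le_mul_of_nonneg_left
      (halfHarm_le_right (hTpos istar) (by linarith [(hw i hi).1]) hTi') (kl_nonneg _ _ _)
  have hstar : tailBound (n * a) ≤ 1 - armProb Q istar := by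
    refine (tailBound_anti ?_).trans
      (tailBound_le_one_sub_armProb hσ hj (h.one_le n hn) (hm j))
    rw [exponent_eq_mul hn0]
    refine mul_le_mul_of_nonneg_left (le_trans ?_ (hlo j hj).le) hn0'.le
    exact mul_le_mul_of_nonneg_left
      (halfHarm_le_right (hTpos istar) (hTpos j).le hTj.le) (kl_nonneg _ _ _)
  have hr : armProb Q i / (1 - armProb Q istar) ≤ Real.exp (-(n * b)) / tailBound (n * a) :=
    div_le_div₀ (Real.exp_pos _).le hα (tailBound_pos _) hstar
  have hr' : armProb Q i ≤ armProb Q i / (1 - armProb Q istar) :=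
    le_div_self (armProb_nonneg _ _) (by linarith) (by linarith [armProb_nonneg Q istar])
  have := stepProb_le_of_ne Q hβ₀ hβ₁ i hlt
  linarith

/-- The proportions of plays converge to the equalising allocation. -/
lemma tendsto_pulls_div (h : RegularPath σ μ β T m) (hK : 2 ≤ K) (hσ : 0 < σ)
    (hβ₀ : 0 < β) (hβ₁ : β < 1) {istar : Fin K} (histar : ∀ i, i ≠ istar → μ i < μ istar)
    {w : Fin K → ℝ} {r : ℝ} (hwstar : w istar = β) (hwsum : ∑ i, w i = 1)
    (hw : ∀ i, i ≠ istar → 0 < w i ∧ kl σ (μ istar) (μ i) * halfHarm β (w i) = r)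
    (i : Fin K) : Tendsto (fun n : ℕ => (T n i : ℝ) / n) atTop (𝓝 (w i)) := by
  have hup : ∀ j, ∀ ε > 0, ∀ᶠ n : ℕ in atTop, (T n j : ℝ) / n ≤ w j + ε := by
    intro j ε hε
    by_cases hj : j = istar
    · subst hj
      rw [hwstar]
      exact ((h.tendsto_pulls_div_best hK hσ hβ₀ hβ₁ histar).eventually_lt_const
        (by linarith)).mono fun n hn => hn.le
    · obtain ⟨φ, hφ, hbal⟩ := h.balance j
      have hδ : 0 < ε / 2 := by positivity
      refine (eventually_le_of_small_above (v := w j + ε / 2) (by linarith [(hw j hj).1])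
        hbal ?_ (fun η hη => ?_) hδ).mono fun n hn => by linarith
      · filter_upwards [eventually_gt_atTop K] with n hn
        rw [hφ n hn]
        exact stepProb_le_one _ hβ₀ hβ₁ j
      · filter_upwards [eventually_gt_atTop K,
          h.eventually_stepProb_le hK hσ hβ₀ hβ₁ histar hwstar hwsum hw hj hδ hη] with n hn hle
        rw [hφ n hn]
        exact hle
  refine tendsto_order.2 ⟨fun a ha => ?_, fun b hb => ?_⟩
  -- The other K - 1 arms exceed `w` by at most ε each and the total exceeds 1 - ε, so arm `i` keeps
  -- more than w i - K ε > a.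
  · set ε := (w i - a) / (K + 1) with hε
    have hεpos : 0 < ε := div_pos (by linarith) (by positivity)
    have hall : ∀ᶠ n : ℕ in atTop, ∀ j, (T n j : ℝ) / n ≤ w j + ε := by
      rw [eventually_all]
      exact fun j => hup j ε hεpos
    filter_upwards [hall, h.tendsto_sum_pulls_div.eventually_const_lt
      (show 1 - ε < 1 by linarith)] with n hn hsum
    have h1 : ∑ j ∈ Finset.univ.erase i, (T n j : ℝ) / n ≤
        ∑ j ∈ Finset.univ.erase i, w j + (K - 1) * ε := by
      refine (Finset.sum_le_sum fun j _ => hn j).trans (le_of_eq ?_)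
      rw [Finset.sum_add_distrib, Finset.sum_const, Finset.card_erase_of_mem (Finset.mem_univ i),
        Finset.card_univ, Fintype.card_fin, nsmul_eq_mul, Nat.cast_sub (by omega), Nat.cast_one]
    rw [← Finset.add_sum_erase _ _ (Finset.mem_univ i)] at hsum hwsum
    have h2 : ε * (K + 1) = w i - a := by
      rw [hε]; field_simp
    nlinarith
  · filter_upwards [hup i ((b - w i) / 2) (by linarith)] with n hn
    linarith

/-- The exponential rate of the posterior probability that `istar` is not optimal. -/
lemma tendsto_log_one_sub_optimalProb (h : RegularPath σ μ β T m) (hK : 2 ≤ K) (hσ : 0 < σ)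
    (hβ₀ : 0 < β) (hβ₁ : β < 1) {istar : Fin K} (histar : ∀ i, i ≠ istar → μ i < μ istar)
    {w : Fin K → ℝ} {r : ℝ} (hwstar : w istar = β) (hwsum : ∑ i, w i = 1)
    (hw : ∀ i, i ≠ istar → 0 < w i ∧ kl σ (μ istar) (μ i) * halfHarm β (w i) = r) :
    Tendsto (fun n : ℕ => -(1 / (n : ℝ)) *
      Real.log (1 - optimalProb (posterior σ (m n) (T n)) istar)) atTop (𝓝 r) := by
  have : Nontrivial (Fin K) := Fin.nontrivial_iff_two_le.2 hK
  obtain ⟨j₀, hj₀⟩ := exists_ne istar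
  have hG : ∀ j, j ≠ istar → Tendsto (fun n : ℕ => kl σ (m n istar) (m n j) *
      halfHarm ((T n istar : ℝ) / n) ((T n j : ℝ) / n)) atTop (𝓝 r) := by
    intro j hj
    rw [← (hw j hj).2]
    have h1 := h.tendsto_pulls_div hK hσ hβ₀ hβ₁ histar hwstar hwsum hw
    exact (h.tendsto_kl hσ hβ₀ hβ₁ istar j).mul
      (tendsto_halfHarm hβ₀ (hw j hj).1.le (hwstar ▸ h1 istar) (h1 j))
  -- One competitor suffices, because all the exponents share the limit `r`.
  have hlow : ∀ b, r < b → ∀ᶠ n : ℕ in atTop,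
      tailBound (n * b) ≤ 1 - optimalProb (posterior σ (m n) (T n)) istar := by
    intro b hb
    filter_upwards [(hG j₀ hj₀).eventually_lt_const hb, eventually_gt_atTop K,
      h.eventually_mean_le hσ hβ₀ hβ₁ histar] with n hlt hn hm
    have hn0 : 0 < n := by omega
    refine (tailBound_anti ?_).trans ((tailBound_le_one_sub_armProb hσ hj₀ (h.one_le n hn)
      (hm j₀)).trans (one_sub_armProb_le_one_sub_optimalProb _ _))
    rw [exponent_eq_mul hn0]
    exact mul_le_mul_of_nonneg_left hlt.le (Nat.cast_nonneg n)
  refine tendsto_order.2 ⟨fun a ha => ?_, fun b hb => ?_⟩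
  · obtain ⟨a', ha₁, ha₂⟩ := exists_between ha
    have hall : ∀ᶠ n : ℕ in atTop, ∀ j, j ≠ istar → a' < kl σ (m n istar) (m n j) *
        halfHarm ((T n istar : ℝ) / n) ((T n j : ℝ) / n) := by
      rw [eventually_all]
      intro j
      by_cases hj : j = istar
      · simp [hj]
      · exact ((hG j hj).eventually_const_lt ha₂).mono fun n hn _ => hn
    have hlim : Tendsto (fun n : ℕ => a' - Real.log K / n) atTop (𝓝 (a' - 0)) :=
      (tendsto_const_div_atTop_nhds_zero_nat _).const_sub a'
    rw [sub_zero] at hlim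
    -- The union bound costs log K / n. `hlow (r + 1)` only provides positivity, so that the
    -- logarithm is monotone.
    filter_upwards [hall, eventually_gt_atTop K, h.eventually_mean_le hσ hβ₀ hβ₁ histar,
      hlow (r + 1) (by linarith), hlim.eventually_const_lt ha₁] with n hall hn hm hpos hlt
    have hn0 : 0 < n := by omega
    have hn0' : (0 : ℝ) < n := by exact_mod_cast hn0
    have hK0 : (0 : ℝ) < K := by exact_mod_cast (by omega : 0 < K)
    have hle : 1 - optimalProb (posterior σ (m n) (T n)) istar ≤ K * Real.exp (-(n * a')) := by
      refine (one_sub_optimalProb_le hσ (h.one_le n hn) hm).trans ?_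
      refine (Finset.sum_le_card_nsmul _ _ (Real.exp (-(n * a'))) fun j hj => ?_).trans ?_
      · rw [exponent_eq_mul hn0]
        refine Real.exp_le_exp.2 (neg_le_neg ?_)
        exact mul_le_mul_of_nonneg_left (hall j (Finset.ne_of_mem_erase hj)).le hn0'.le
      · rw [nsmul_eq_mul]
        refine mul_le_mul_of_nonneg_right ?_ (Real.exp_pos _).le
        exact_mod_cast (Finset.card_le_univ _).trans_eq (Fintype.card_fin K)
    have hlog := Real.log_le_log ((tailBound_pos _).trans_le hpos) hle
    rw [Real.log_mul hK0.ne' (Real.exp_pos _).ne', Real.log_exp] at hlog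
    refine hlt.trans_le ?_
    have h1 : a' - Real.log K / n = -(1 / (n : ℝ)) * (Real.log K + -(n * a')) := by
      field_simp
      ring
    rw [h1]
    exact mul_le_mul_of_nonpos_left hlog (by simp)
  · obtain ⟨b', hb₁, hb₂⟩ := exists_between hb
    filter_upwards [hlow b' hb₁, (tendsto_log_tailBound b').eventually_lt_const hb₂]
      with n hle hlt
    refine lt_of_le_of_lt ?_ hlt
    exact mul_le_mul_of_nonpos_left (Real.log_le_log (tailBound_pos _) hle) (by simp)

end RegularPath

/-! ### From almost sure properties to the theorem -/

section Paths

variable {K : ℕ} {Ω : Type*}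

lemma empMean_succ (I : ℕ → Ω → Fin K) (Y : ℕ → Ω → Fin K → ℝ) {n : ℕ} (hn : 1 ≤ n) (ω : Ω)
    (i : Fin K) (h : pulls I (n + 1) ω i = pulls I n ω i) :
    empMean I Y (n + 1) ω i = empMean I Y n ω i := by
  have hi : I n ω ≠ i := by
    intro hi
    rw [pulls_succ I hn, if_pos hi] at h
    omega
  rw [empMean, empMean, h, Finset.sum_Ico_succ_top hn, if_neg hi, add_zero]

lemma IsTTTS.ae_regularPath [NeZero K] [MeasurableSpace Ω] {P : Measure Ω}
    [IsProbabilityMeasure P] {σ : ℝ} {μ : Fin K → ℝ} {β : ℝ} {I : ℕ → Ω → Fin K}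
    {Y : ℕ → Ω → Fin K → ℝ} (h : IsTTTS P σ μ β I Y) :
    ∀ᵐ ω ∂P, RegularPath σ μ β (fun n => pulls I n ω) (fun n => empMean I Y n ω) := by
  filter_upwards [h.init, h.ae_tendsto_empMean, h.ae_tendsto_pulls_sub_sum] with ω h1 h2 h3
  exact
    { one_le := fun n hn i => (h1 i).symm.le.trans (pulls_mono I ω i hn)
      mono := pulls_mono I ω
      sum_eq := fun n => sum_pulls I n ω
      mean_succ := fun n hn i => empMean_succ I Y hn ω i
      consistent := h2
      balance := h3 }

end Paths

end GaussianTopTwo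

theorem theorem4 {K : ℕ} [NeZero K] (hK : 2 ≤ K)
    (σ : ℝ) (hσ : 0 < σ) (μ : Fin K → ℝ)
    (istar : Fin K) (histar : ∀ i, i ≠ istar → μ i < μ istar)
    (β : ℝ) (hβ₀ : 0 < β) (hβ₁ : β < 1)
    {Ω : Type*} [MeasurableSpace Ω] (P : Measure Ω) [IsProbabilityMeasure P]
    (I : ℕ → Ω → Fin K) (Y : ℕ → Ω → Fin K → ℝ)
    (hTTTS : GaussianTopTwo.IsTTTS P σ μ β I Y) :
    (∀ᵐ ω ∂P, Tendsto
      (fun n : ℕ => -(1 / (n : ℝ)) * Real.log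
        (1 - GaussianTopTwo.optimalProb (GaussianTopTwo.posteriorAt σ I Y n ω) istar))
      atTop (𝓝 (GaussianTopTwo.optimalRate σ μ istar β))) ∧
    ∃ w : Fin K → ℝ,
      (∀ w', GaussianTopTwo.IsOptimalAllocation σ μ istar β w' ↔ w' = w) ∧
      ∀ᵐ ω ∂P, ∀ i, Tendsto
        (fun n : ℕ => (GaussianTopTwo.pulls I n ω i : ℝ) / (n : ℝ)) atTop (𝓝 (w i)) := by
  obtain ⟨w, hwstar, hwsum, hw, hopt⟩ :=
    GaussianTopTwo.exists_optimalAllocation hK hσ μ istar histar hβ₀ hβ₁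
  refine ⟨?_, w, hopt, ?_⟩
  · filter_upwards [hTTTS.ae_regularPath] with ω h
    exact h.tendsto_log_one_sub_optimalProb hK hσ hβ₀ hβ₁ histar hwstar hwsum hw
  · filter_upwards [hTTTS.ae_regularPath] with ω h
    exact h.tendsto_pulls_div hK hσ hβ₀ hβ₁ histar hwstar hwsum hw
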